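/- Let $X$ be a complex Banach space and let $S$ be a densely defined linear operator in $X$ with domain $\mathcal D(S)$, resolvent set $\varrho(S)$ and spectrum $\sigma(S)$. Suppose that for some $h>0$ $$\{\lambda\in\mathbb C : |\operatorname{Re}\lambda|\le h\}\subset\varrho(S),\qquad \sup_{|\operatorname{Re}\lambda|\le h}\|(S-\lambda)^{-1}\|<\infty .$$ Write $\mathbb C_\pm$ for the open right and left half-planes, and let $G_\pm$ be the subspace of all $x\in X$ for which $\lambda\mapsto(S-\lambda)^{-1}x$, $\lambda\in\varrho(S)$, has an analytic extension to (a neighbourhood of) $\overline{\mathbb C_\mp}\cup\varrho(S)$ that is bounded on $\overline{\mathbb C_\mp}$. Let $$A_\pm=\frac{\pm1}{2\pi i}\int_{\pm h-i\infty}^{\pm h+i\infty}\frac1{\lambda^2}(S-\lambda)^{-1}\,d\lambda\in L(X),\qquad P_\pm=S^2A_\pm,\quad \mathcal D(P_\pm)=\{x\in X: A_\pm x\in\mathcal D(S^2)\},$$ $$Px=\frac1{2\pi i}\int_{h-i\infty}^{h+i\infty}\frac1{\lambda^2}(S-\lambda)^{-1}S^2x\,d\lambda,\qquad x\in\mathcal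 D(S^2);$$ these integrals converge absolutely. The operator $S$ is called strictly dichotomous if $i\mathbb R\subset\varrho(S)$ and there are closed $S$-invariant subspaces $X_\pm$ with $X=X_+\oplus X_-$, $\sigma(S|X_\pm)\subset\mathbb C_\pm$, such that $\|(S|X_+-\lambda)^{-1}\|$ is bounded on $\overline{\mathbb C_-}$ and $\|(S|X_--\lambda)^{-1}\|$ is bounded on $\overline{\mathbb C_+}$. Then $G_+\cap G_-=\{0\}$, the sum $G_+\oplus G_-$ is dense in $X$, and $P_+$ and $P_-$ are closed, densely defined (possibly unbounded) projections. Moreover, the following assertions are equivalent: (i) $S$ is strictly dichotomous; (ii) $P_+$ is bounded on some dense subspace of $\mathcal D(P_+)$; (iii) $P$ is bounded on some dense subspace of $\mathcal D(S^2)$. In this case $P_+\in L(X)$, and $P_+$ is the unique bounded extension of $P$ to $X$. -/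

import Mathlib

noncomputable section

namespace LinearPMap

variable {E F G : Type*} [AddCommGroup E] [Module ℂ E] [AddCommGroup F] [Module ℂ F]
  [AddCommGroup G] [Module ℂ G]

/-- The product `g f` of two unbounded operators, on its natural domain
`{x ∈ D(f) | f x ∈ D(g)}`. -/
def pcomp (g : F →ₗ.[ℂ] G) (f : E →ₗ.[ℂ] F) : E →ₗ.[ℂ] G where
  domain :=
    { carrier := {x | ∃ hx : x ∈ f.domain, f ⟨x, hx⟩ ∈ g.domain}
      zero_mem' := ⟨f.domain.zero_mem, by
        have h : f ⟨0, f.domain.zero_mem⟩ = 0 := f.map_zero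
        rw [h]; exact g.domain.zero_mem⟩
      add_mem' := by
        rintro x y ⟨hx, hx'⟩ ⟨hy, hy'⟩
        refine ⟨f.domain.add_mem hx hy, ?_⟩
        have h := f.map_add ⟨x, hx⟩ ⟨y, hy⟩
        rw [AddMemClass.mk_add_mk] at h
        rw [h]; exact g.domain.add_mem hx' hy'
      smul_mem' := by
        rintro c x ⟨hx, hx'⟩
        refine ⟨f.domain.smul_mem c hx, ?_⟩
        have h := f.map_smul c ⟨x, hx⟩
        rw [SetLike.mk_smul_mk] at h
        rw [h]; exact g.domain.smul_mem c hx' }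
  toFun :=
    { toFun := fun x => g ⟨f ⟨x.1, x.2.1⟩, x.2.2⟩
      map_add' := by
        rintro ⟨x, hx, hx'⟩ ⟨y, hy, hy'⟩
        rw [← g.map_add]
        congr 1
        exact Subtype.ext (f.map_add ⟨x, hx⟩ ⟨y, hy⟩)
      map_smul' := by
        rintro c ⟨x, hx, hx'⟩
        rw [RingHom.id_apply, ← g.map_smul]
        congr 1
        exact Subtype.ext (f.map_smul c ⟨x, hx⟩) }

/-- The square `S²` of an unbounded operator, with `D(S²) = {x ∈ D(S) | S x ∈ D(S)}`. -/
def square (S : E →ₗ.[ℂ] E) : E →ₗ.[ℂ] E := S.pcomp S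

/-- A subspace `V` is `S`-invariant if `S (D(S) ∩ V) ⊆ V`. -/
def IsInvariant (S : E →ₗ.[ℂ] E) (V : Submodule ℂ E) : Prop :=
  ∀ x : S.domain, (x : E) ∈ V → S x ∈ V

/-- The restriction `S|V` of `S` to an invariant subspace `V`, as an operator in `V`
with domain `D(S) ∩ V`. -/
def restrictTo (S : E →ₗ.[ℂ] E) (V : Submodule ℂ E) (hV : S.IsInvariant V) : V →ₗ.[ℂ] V where
  domain := S.domain.comap V.subtype
  toFun :=
    { toFun := fun x => ⟨S ⟨((x : V) : E), x.2⟩, hV _ x.1.2⟩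
      map_add' := fun x y => Subtype.ext (S.map_add ⟨((x : V) : E), x.2⟩ ⟨((y : V) : E), y.2⟩)
      map_smul' := fun c x => Subtype.ext (S.map_smul c ⟨((x : V) : E), x.2⟩) }

/-- A possibly unbounded projection: the range of `P` lies in `D(P)` and `P² = P`. -/
def IsProjection (P : E →ₗ.[ℂ] E) : Prop :=
  ∀ x : P.domain, ∃ h : P x ∈ P.domain, P ⟨P x, h⟩ = P x

end LinearPMap

namespace LinearPMap

variable {X : Type*} [NormedAddCommGroup X] [NormedSpace ℂ X]

/-- `R` is a bounded, everywhere defined, two-sided inverse of `S - z : D(S) → X`. -/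
def IsResolventAt (S : X →ₗ.[ℂ] X) (z : ℂ) (R : X →L[ℂ] X) : Prop :=
  (∀ y : X, ∃ h : R y ∈ S.domain, S ⟨R y, h⟩ - z • R y = y) ∧
    ∀ x : S.domain, R (S x - z • (x : X)) = x

/-- The resolvent set `ϱ(S)`. -/
def resolventSet (S : X →ₗ.[ℂ] X) : Set ℂ := {z | ∃ R : X →L[ℂ] X, S.IsResolventAt z R}

/-- The spectrum `σ(S)`. -/
def spec (S : X →ₗ.[ℂ] X) : Set ℂ := (S.resolventSet)ᶜ

open Classical in
/-- The resolvent `(S - z)⁻¹` for `z ∈ ϱ(S)` (and `0` elsewhere). -/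
def resolventOp (S : X →ₗ.[ℂ] X) (z : ℂ) : X →L[ℂ] X :=
  if h : ∃ R : X →L[ℂ] X, S.IsResolventAt z R then h.choose else 0

/-- `S` is strictly dichotomous with respect to the decomposition `X = Xp ⊕ Xm` into
closed subspaces. -/
structure IsStrictlyDichotomousWrt (S : X →ₗ.[ℂ] X) (Xp Xm : Submodule ℂ X) : Prop where
  isClosed_pos : _root_.IsClosed (Xp : Set X)
  isClosed_neg : _root_.IsClosed (Xm : Set X)
  isCompl : IsCompl Xp Xm
  imaginary_axis : {z : ℂ | z.re = 0} ⊆ S.resolventSet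
  inv_pos : S.IsInvariant Xp
  inv_neg : S.IsInvariant Xm
  spec_pos : (S.restrictTo Xp inv_pos).spec ⊆ {z : ℂ | 0 < z.re}
  spec_neg : (S.restrictTo Xm inv_neg).spec ⊆ {z : ℂ | z.re < 0}
  bdd_pos : ∃ M : ℝ, ∀ z : ℂ, z.re ≤ 0 → ‖(S.restrictTo Xp inv_pos).resolventOp z‖ ≤ M
  bdd_neg : ∃ M : ℝ, ∀ z : ℂ, 0 ≤ z.re → ‖(S.restrictTo Xm inv_neg).resolventOp z‖ ≤ M

/-- `S` is strictly dichotomous (with respect to some decomposition). -/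
def IsStrictlyDichotomous (S : X →ₗ.[ℂ] X) : Prop :=
  ∃ Xp Xm : Submodule ℂ X, S.IsStrictlyDichotomousWrt Xp Xm

/-- The vectors `x` for which `z ↦ (S - z)⁻¹ x`, `z ∈ ϱ(S)`, has an extension to `H ∪ ϱ(S)`
that is analytic (in a neighbourhood of that set) and bounded on `H`. -/
def extensionSpace (S : X →ₗ.[ℂ] X) (H : Set ℂ) : Submodule ℂ X where
  carrier := {x | ∃ φ : ℂ → X, AnalyticOnNhd ℂ φ (H ∪ S.resolventSet) ∧
    (∀ z ∈ S.resolventSet, φ z = S.resolventOp z x) ∧ ∃ C : ℝ, ∀ z ∈ H, ‖φ z‖ ≤ C}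
  zero_mem' := ⟨fun _ => 0, analyticOnNhd_const, by simp, 0, by simp⟩
  add_mem' := by
    rintro x y ⟨φ, h₁, h₂, C, h₃⟩ ⟨ψ, k₁, k₂, D, k₃⟩
    refine ⟨φ + ψ, h₁.add k₁, fun z hz => ?_, C + D, fun z hz => ?_⟩
    · simp [h₂ z hz, k₂ z hz]
    · exact (norm_add_le _ _).trans (add_le_add (h₃ z hz) (k₃ z hz))
  smul_mem' := by
    rintro c x ⟨φ, h₁, h₂, C, h₃⟩
    refine ⟨c • φ, h₁.const_smul, fun z hz => ?_, ‖c‖ * C, fun z hz => ?_⟩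
    · simp [h₂ z hz]
    · rw [Pi.smul_apply, norm_smul]
      exact mul_le_mul_of_nonneg_left (h₃ z hz) (norm_nonneg c)

/-- `G₊`: bounded analytic extension to the closed left half-plane. -/
def Gplus (S : X →ₗ.[ℂ] X) : Submodule ℂ X := S.extensionSpace {z : ℂ | z.re ≤ 0}

/-- `G₋`: bounded analytic extension to the closed right half-plane. -/
def Gminus (S : X →ₗ.[ℂ] X) : Submodule ℂ X := S.extensionSpace {z : ℂ | 0 ≤ z.re}

end LinearPMap

/-- `∫_{a - i∞}^{a + i∞} f(z) dz`, parametrised by `z = a + i t`, `dz = i dt`. -/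
def verticalIntegral {E : Type*} [NormedAddCommGroup E] [NormedSpace ℂ E] (a : ℝ) (f : ℂ → E) :
    E :=
  ∫ t : ℝ, Complex.I • f ((a : ℂ) + (t : ℂ) * Complex.I)

/-- Absolute convergence of `∫_{a - i∞}^{a + i∞} f(z) dz`. -/
def VerticalIntegrable {E : Type*} [NormedAddCommGroup E] (a : ℝ) (f : ℂ → E) : Prop :=
  MeasureTheory.Integrable fun t : ℝ => f ((a : ℂ) + (t : ℂ) * Complex.I)

namespace LinearPMap

variable {X : Type*} [NormedAddCommGroup X] [NormedSpace ℂ X]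

/-- `A₊ = (1 / 2πi) ∫_{h - i∞}^{h + i∞} z⁻² (S - z)⁻¹ dz`, in the operator norm. -/
def Aplus (S : X →ₗ.[ℂ] X) (h : ℝ) : X →L[ℂ] X :=
  (1 / (2 * (Real.pi : ℂ) * Complex.I)) •
    verticalIntegral h fun z : ℂ => (1 / z ^ 2) • S.resolventOp z

/-- `A₋ = (-1 / 2πi) ∫_{-h - i∞}^{-h + i∞} z⁻² (S - z)⁻¹ dz`, in the operator norm. -/
def Aminus (S : X →ₗ.[ℂ] X) (h : ℝ) : X →L[ℂ] X :=
  (-1 / (2 * (Real.pi : ℂ) * Complex.I)) •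
    verticalIntegral (-h) fun z : ℂ => (1 / z ^ 2) • S.resolventOp z

/-- A bounded operator as an unbounded operator with domain the whole space. -/
def ofCLM (A : X →L[ℂ] X) : X →ₗ.[ℂ] X := (A : X →ₗ[ℂ] X).toPMap ⊤

/-- `P₊ = S² A₊`, with domain `{x | A₊ x ∈ D(S²)}`. -/
def Pplus (S : X →ₗ.[ℂ] X) (h : ℝ) : X →ₗ.[ℂ] X := S.square.pcomp (ofCLM (S.Aplus h))

/-- `P₋ = S² A₋`, with domain `{x | A₋ x ∈ D(S²)}`. -/
def Pminus (S : X →ₗ.[ℂ] X) (h : ℝ) : X →ₗ.[ℂ] X := S.square.pcomp (ofCLM (S.Aminus h))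

/-- The operator `P x = (1 / 2πi) ∫_{h - i∞}^{h + i∞} z⁻² (S - z)⁻¹ S² x dz` on `D(S²)`. -/
def Pint (S : X →ₗ.[ℂ] X) (h : ℝ) (x : S.square.domain) : X :=
  (1 / (2 * (Real.pi : ℂ) * Complex.I)) •
    verticalIntegral h fun z : ℂ => (1 / z ^ 2) • S.resolventOp z (S.square x)

end LinearPMap

/-- The map `f`, defined on the subspace `D`, is bounded on some dense subspace `W` of `D`. -/
def BoundedOnDenseSubspace {X : Type*} [NormedAddCommGroup X] [NormedSpace ℂ X]
    (D : Submodule ℂ X) (f : D → X) : Prop :=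
  ∃ W : Submodule ℂ X, W ≤ D ∧ (D : Set X) ⊆ closure (W : Set X) ∧
    ∃ C : ℝ, ∀ x : D, (x : X) ∈ W → ‖f x‖ ≤ C * ‖(x : X)‖

end

open Filter Topology MeasureTheory

namespace LinearPMap

/-! ### Resolvents, the reflection `S ↦ -S`, and the domain of `S²`. -/

section Resolvent

variable {X : Type*} [NormedAddCommGroup X] [NormedSpace ℂ X] {S : X →ₗ.[ℂ] X}

/-! Write `R z` for `(S - z)⁻¹`. The bounded operators `A₊` and `A₋` stand in for the possibly
unbounded projections: `A₊ = S⁻² P₊` and `A₋ = S⁻² P₋`, and everything reduces to two relations.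
Cauchy's theorem on the strip gives `A₊ + A₋ = S⁻²` (`Aplus_add_Aminus`). The Cauchy integral
`leftExtension` continues `z ↦ R z A₊` boundedly to the left half-plane, so the range of `A₊` lies
in `G₊` (`Aplus_mem_Gplus`); Liouville's theorem gives `G₊ ∩ G₋ = 0` (`disjoint_G`). As `A₊`
commutes with resolvents, it maps `G₋` into `G₊ ∩ G₋`, hence kills it, and `A₊ A₋ = A₋ A₊ = 0`.

Since `0 ∈ ϱ(S)`, the graph of `P₊` is `{(x, y) | A₊ x = S⁻² y}`. Closedness is immediate, the two
relations give `P₊² = P₊`, and density holds because `D(S²)`, the range of `S⁻²`, is dense and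
contained in `D(P₊)`. That range also lies in `G₊ + G₋`.

For the equivalence, the pivot is a factorization `A₊ = S⁻² B` with `B` bounded. If `S` is strictly
dichotomous, then `X₊ ⊆ G₊` and `X₋ ⊆ G₋` (`le_Gplus`), so the projection onto `X₊` along `X₋`
serves as `B`. If `P₊` is bounded on a dense subspace, `B` is its continuous extension. Conversely,
given `B`, take `X₊ = ker A₋` and `X₋ = ker A₊` (`isStrictlyDichotomousWrt_of_Aplus_eq`). On `ker
A₋` one has `A₊ = S⁻²`, so `leftExtension` yields the resolvent of the restriction on the left
half-plane, a priori with quadratic growth; Phragmén–Lindelöf (`norm_le_of_quadratic_growth`)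
improves this to the bound on the imaginary axis. The statements for the minus sign follow by
replacing `S` with `-S`. -/

theorem IsResolventAt.unique {z : ℂ} {R R' : X →L[ℂ] X} (hR : S.IsResolventAt z R)
    (hR' : S.IsResolventAt z R') : R = R' := by
  ext y
  obtain ⟨hy, e⟩ := hR.1 y
  have := hR'.2 ⟨R y, hy⟩
  rw [e] at this
  exact this.symm

theorem isResolventAt_resolventOp {z : ℂ} (hz : z ∈ S.resolventSet) :
    S.IsResolventAt z (S.resolventOp z) := by
  have h : ∃ R : X →L[ℂ] X, S.IsResolventAt z R := hz
  rw [resolventOp, dif_pos h]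
  exact h.choose_spec

theorem IsResolventAt.resolventOp_eq {z : ℂ} {R : X →L[ℂ] X} (hR : S.IsResolventAt z R) :
    S.resolventOp z = R :=
  (isResolventAt_resolventOp ⟨R, hR⟩).unique hR

/-- A vector solving `(S - z) x = y` is `(S - z)⁻¹ y`. -/
theorem IsResolventAt.apply_eq {z : ℂ} {R : X →L[ℂ] X} (hR : S.IsResolventAt z R) {x y : X}
    (hx : x ∈ S.domain) (e : S ⟨x, hx⟩ - z • x = y) : R y = x := by
  rw [← e]
  exact hR.2 ⟨x, hx⟩

theorem IsResolventAt.identity {z w : ℂ} {R Q : X →L[ℂ] X} (hR : S.IsResolventAt z R)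
    (hQ : S.IsResolventAt w Q) : R = Q + (z - w) • (Q * R) := by
  ext y
  obtain ⟨hy, e⟩ := hR.1 y
  have := hQ.2 ⟨R y, hy⟩
  have e' : S ⟨R y, hy⟩ - w • R y = y + (z - w) • R y := by
    rw [sub_eq_iff_eq_add.mp e]
    module
  simp only [e', _root_.map_add, _root_.map_smul] at this
  simpa using this.symm

theorem IsResolventAt.commute {z w : ℂ} {R Q : X →L[ℂ] X} (hR : S.IsResolventAt z R)
    (hQ : S.IsResolventAt w Q) : Commute R Q := by
  by_cases hzw : z = w
  · subst hzw
    rw [hR.unique hQ]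
  · have h1 := hR.identity hQ
    have h2 := hQ.identity hR
    have h3 : (z - w) • (Q * R) = (z - w) • (R * Q) := by
      have : (z - w) • (R * Q) = -((w - z) • (R * Q)) := by rw [← neg_smul, neg_sub]
      rw [this, eq_sub_of_add_eq' h1.symm, eq_sub_of_add_eq' h2.symm, neg_sub]
    exact (smul_right_injective _ (sub_ne_zero.mpr hzw) h3).symm

/-- Comes from the factorization `S - z = (1 - (z - w) Q) (S - w)`. It reduces openness of `ϱ(S)`
and analyticity of the resolvent to inversion in the Banach algebra. -/
theorem IsResolventAt.of_mul_eq_one {z w : ℂ} {Q U : X →L[ℂ] X} (hQ : S.IsResolventAt w Q)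
    (h1 : (1 - (z - w) • Q) * U = 1) (h2 : U * (1 - (z - w) • Q) = 1) :
    S.IsResolventAt z (Q * U) := by
  have hc : U * Q = Q * U := by
    have h3 : (1 - (z - w) • Q) * Q = Q * (1 - (z - w) • Q) := by
      simp [sub_mul, mul_sub]
    calc U * Q = U * (Q * (1 - (z - w) • Q)) * U := by
          rw [mul_assoc, mul_assoc, h1, mul_one]
      _ = Q * U := by rw [← h3, ← mul_assoc, h2, one_mul]
  refine ⟨fun y => ?_, fun x => ?_⟩
  · obtain ⟨hy, e⟩ := hQ.1 (U y)
    refine ⟨hy, ?_⟩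
    have h4 := DFunLike.congr_fun h1 y
    simp only [mul_apply_eq_comp, _root_.sub_apply,
      one_apply_eq_self, _root_.smul_apply] at h4 ⊢
    rw [sub_eq_iff_eq_add.mp e]
    nth_rw 4 [← h4]
    module
  · have h4 := DFunLike.congr_fun h2 (x : X)
    have h5 := hQ.2 x
    rw [← hc]
    simp only [mul_apply_eq_comp, _root_.sub_apply,
      one_apply_eq_self, _root_.smul_apply] at h4 ⊢
    refine Eq.trans ?_ h4
    congr 1
    simp only [_root_.map_sub, _root_.map_smul] at h5 ⊢
    rw [sub_eq_iff_eq_add.mp h5]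
    module

theorem resolventSet_mem_nhds_and_analyticAt [CompleteSpace X] {w : ℂ}
    (hw : w ∈ S.resolventSet) :
    S.resolventSet ∈ 𝓝 w ∧ AnalyticAt ℂ S.resolventOp w := by
  have hQ := isResolventAt_resolventOp hw
  set Q := S.resolventOp w
  have hd : AnalyticAt ℂ (fun z : ℂ => (1 : X →L[ℂ] X) - (z - w) • Q) w := by fun_prop
  have hone : (1 : X →L[ℂ] X) - (w - w) • Q = ((1 : (X →L[ℂ] X)ˣ) : X →L[ℂ] X) := by simp
  have hev : ∀ᶠ z in 𝓝 w, IsUnit ((1 : X →L[ℂ] X) - (z - w) • Q) := by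
    apply hd.continuousAt.eventually
    change ∀ᶠ y in 𝓝 ((1 : X →L[ℂ] X) - (w - w) • Q), IsUnit y
    rw [hone]
    exact Units.nhds _
  have hres : ∀ᶠ z in 𝓝 w,
      S.IsResolventAt z (Q * Ring.inverse ((1 : X →L[ℂ] X) - (z - w) • Q)) := by
    filter_upwards [hev] with z hz
    exact hQ.of_mul_eq_one (Ring.mul_inverse_cancel _ hz) (Ring.inverse_mul_cancel _ hz)
  refine ⟨?_, ?_⟩
  · filter_upwards [hres] with z hz using ⟨_, hz⟩
  · have hi : AnalyticAt ℂ (Ring.inverse : (X →L[ℂ] X) → _) (1 - (w - w) • Q) := by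
      rw [hone]; exact analyticAt_inverse _
    have := (analyticAt_const (v := Q)).mul
      (AnalyticAt.fun_comp (f := fun z : ℂ => (1 : X →L[ℂ] X) - (z - w) • Q) hi hd)
    refine this.congr ?_
    filter_upwards [hres] with z hz using hz.resolventOp_eq.symm

theorem isOpen_resolventSet [CompleteSpace X] (S : X →ₗ.[ℂ] X) : IsOpen S.resolventSet :=
  isOpen_iff_mem_nhds.mpr fun _ hw => (resolventSet_mem_nhds_and_analyticAt hw).1

theorem analyticOnNhd_resolventOp [CompleteSpace X] (S : X →ₗ.[ℂ] X) :
    AnalyticOnNhd ℂ S.resolventOp S.resolventSet :=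
  fun _ hw => (resolventSet_mem_nhds_and_analyticAt hw).2

/-- Reflection exchanges the two half-planes; through it each result on `A₊`, `G₊` and `X₊` yields
its counterpart with the minus sign. -/
theorem isResolventAt_neg_iff {z : ℂ} {R : X →L[ℂ] X} :
    (-S).IsResolventAt z R ↔ S.IsResolventAt (-z) (-R) := by
  refine and_congr (forall_congr' fun y => ?_) (forall_congr' fun x => ?_)
  · constructor
    · rintro ⟨hy, e⟩
      have hy' : R y ∈ S.domain := hy
      refine ⟨S.domain.neg_mem hy', ?_⟩
      have : S ⟨-R y, S.domain.neg_mem hy'⟩ = -S ⟨R y, hy'⟩ := S.map_neg ⟨R y, hy'⟩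
      simp only [_root_.neg_apply, this]
      rw [neg_apply] at e
      refine Eq.trans ?_ e
      change -S ⟨R y, hy'⟩ - (-z) • -(R y) = -S ⟨R y, hy'⟩ - z • R y
      module
    · rintro ⟨hy, e⟩
      have hy' : R y ∈ S.domain := by simpa using hy
      refine ⟨hy', ?_⟩
      have : S ⟨-R y, S.domain.neg_mem hy'⟩ = -S ⟨R y, hy'⟩ := S.map_neg ⟨R y, hy'⟩
      simp only [_root_.neg_apply, this] at e
      rw [neg_apply]
      refine Eq.trans ?_ e
      change -S ⟨R y, hy'⟩ - z • R y = -S ⟨R y, hy'⟩ - (-z) • -(R y)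
      module
  · have : (-R) (S x - (-z) • (x : X)) = R ((-S) x - z • (x : X)) := by
      rw [neg_apply, _root_.neg_apply, ← _root_.map_neg]
      congr 1
      module
    rw [← this]

theorem mem_resolventSet_neg_iff {z : ℂ} : z ∈ (-S).resolventSet ↔ -z ∈ S.resolventSet :=
  ⟨fun ⟨R, hR⟩ => ⟨-R, isResolventAt_neg_iff.mp hR⟩,
    fun ⟨R, hR⟩ => ⟨-R, isResolventAt_neg_iff.mpr (by rwa [neg_neg])⟩⟩

theorem resolventOp_neg (z : ℂ) : (-S).resolventOp z = -S.resolventOp (-z) := by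
  by_cases hz : -z ∈ S.resolventSet
  · apply IsResolventAt.resolventOp_eq
    rw [isResolventAt_neg_iff, neg_neg]
    exact isResolventAt_resolventOp hz
  · have hz' : ¬ ∃ R, S.IsResolventAt (-z) R := hz
    have hz'' : ¬ ∃ R, (-S).IsResolventAt z R := fun h' => hz (mem_resolventSet_neg_iff.mp h')
    simp [resolventOp, dif_neg hz', dif_neg hz'']

/-- If `0 ∈ ϱ(S)` then `x ∈ D(S²)` and `S² x = y` exactly when `x = S⁻² y`. -/
theorem IsResolventAt.square_iff {R : X →L[ℂ] X} (hR : S.IsResolventAt 0 R) {x y : X} :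
    (∃ hx : x ∈ S.square.domain, S.square ⟨x, hx⟩ = y) ↔ x = R (R y) := by
  constructor
  · rintro ⟨⟨hx, hx'⟩, e⟩
    have e' : S ⟨S ⟨x, hx⟩, hx'⟩ = y := e
    have h1 : R y = S ⟨x, hx⟩ := hR.apply_eq hx' (by rw [zero_smul, sub_zero, e'])
    rw [h1, hR.apply_eq hx (by rw [zero_smul, sub_zero])]
  · rintro rfl
    obtain ⟨h1, e1⟩ := hR.1 (R y)
    obtain ⟨h2, e2⟩ := hR.1 y
    rw [zero_smul, sub_zero] at e1 e2
    refine ⟨⟨h1, by rwa [e1]⟩, ?_⟩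
    change S ⟨S ⟨R (R y), h1⟩, _⟩ = y
    simp only [e1, e2]

theorem IsResolventAt.injective {z : ℂ} {R : X →L[ℂ] X} (hR : S.IsResolventAt z R) :
    Function.Injective R := by
  intro x y hxy
  obtain ⟨h1, e1⟩ := hR.1 x
  obtain ⟨h2, e2⟩ := hR.1 y
  rw [← e1, ← e2]
  simp only [hxy]

/-- `R` has range `D(S)`, and a composite of continuous maps with dense range has dense range. -/
theorem IsResolventAt.dense_square_domain {R : X →L[ℂ] X} (hR : S.IsResolventAt 0 R)
    (hd : Dense (S.domain : Set X)) : Dense (S.square.domain : Set X) := by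
  have hr : DenseRange R := hd.mono fun x hx =>
    ⟨S ⟨x, hx⟩, hR.apply_eq hx (by rw [zero_smul, sub_zero])⟩
  refine (hr.comp hr R.continuous).mono ?_
  rintro _ ⟨y, rfl⟩
  exact (hR.square_iff.mpr rfl).1

end Resolvent

end LinearPMap

/-! ### Integrals along vertical lines and Cauchy's theorem. -/

section VerticalIntegral

open Complex (I)

variable {E : Type*} [NormedAddCommGroup E]

theorem integrable_inv_sq_add_sq {a : ℝ} (ha : a ≠ 0) :
    Integrable fun t : ℝ => (a ^ 2 + t ^ 2)⁻¹ := by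
  have := (integrable_inv_one_add_sq.comp_div ha).const_mul (a ^ 2)⁻¹
  refine this.congr (Eventually.of_forall fun t => ?_)
  simp only
  rw [← mul_inv]
  congr 1
  field_simp

theorem integral_univ_inv_sq_add_sq {a : ℝ} (ha : 0 < a) :
    ∫ t : ℝ, (a ^ 2 + t ^ 2)⁻¹ = Real.pi / a := by
  have h1 : (fun t : ℝ => (a ^ 2 + t ^ 2)⁻¹) = fun t => (a ^ 2)⁻¹ * (1 + (t / a) ^ 2)⁻¹ := by
    funext t
    rw [← mul_inv]
    congr 1
    field_simp
  rw [h1, integral_const_mul, Measure.integral_comp_div (fun t : ℝ => (1 + t ^ 2)⁻¹) a,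
    integral_univ_inv_one_add_sq, abs_of_pos ha, smul_eq_mul]
  field_simp

theorem norm_sq_vertical (a t : ℝ) : ‖(a : ℂ) + (t : ℂ) * I‖ ^ 2 = a ^ 2 + t ^ 2 := by
  rw [← Complex.normSq_eq_norm_sq, Complex.normSq_add_mul_I]

theorem vertical_ne_zero {a : ℝ} (ha : a ≠ 0) (t : ℝ) : (a : ℂ) + (t : ℂ) * I ≠ 0 := by
  intro h
  apply ha
  simpa using congrArg Complex.re h

theorem continuous_vertical {F : Type*} [TopologicalSpace F] {f : ℂ → F} {a : ℝ} {s : Set ℂ}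
    (hf : ContinuousOn f s) (hs : ∀ z : ℂ, z.re = a → z ∈ s) :
    Continuous fun t : ℝ => f ((a : ℂ) + (t : ℂ) * I) :=
  hf.comp_continuous (by fun_prop) fun t => hs _ (by simp)

theorem verticalIntegrable_of_norm_le {f : ℂ → E} {a C : ℝ} (ha : a ≠ 0)
    (hf : Continuous fun t : ℝ => f ((a : ℂ) + (t : ℂ) * I))
    (hC : ∀ z : ℂ, z.re = a → ‖f z‖ ≤ C * (‖z‖ ^ 2)⁻¹) : VerticalIntegrable a f := by
  refine ((integrable_inv_sq_add_sq ha).const_mul C).mono' hf.aestronglyMeasurable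
    (Eventually.of_forall fun t => ?_)
  rw [← norm_sq_vertical]
  exact hC _ (by simp)

variable [NormedSpace ℂ E]

theorem norm_verticalIntegral_le {f : ℂ → E} {a C : ℝ} (ha : 0 < a)
    (hC : ∀ z : ℂ, z.re = a → ‖f z‖ ≤ C * (‖z‖ ^ 2)⁻¹) :
    ‖verticalIntegral a f‖ ≤ C * (Real.pi / a) := by
  rw [← integral_univ_inv_sq_add_sq ha, ← integral_const_mul]
  refine norm_integral_le_of_norm_le ((integrable_inv_sq_add_sq ha.ne').const_mul C)
    (Eventually.of_forall fun t => ?_)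
  rw [← norm_sq_vertical, norm_smul, Complex.norm_I, one_mul]
  exact hC _ (by simp)

theorem verticalIntegral_neg (a : ℝ) (f : ℂ → E) :
    verticalIntegral (-a) f = verticalIntegral a fun z => f (-z) := by
  unfold verticalIntegral
  rw [← integral_neg_eq_self]
  congr 1
  funext t
  congr 2
  push_cast
  ring

/-- Cauchy's theorem for a vertical strip. -/
theorem verticalIntegral_eq_of_strip {f : ℂ → E} {a b C : ℝ} (ha : a ≠ 0) (hb : b ≠ 0)
    (hab : a ≤ b) (hC0 : 0 ≤ C) (hf : DifferentiableOn ℂ f {z | a ≤ z.re ∧ z.re ≤ b})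
    (hC : ∀ z : ℂ, a ≤ z.re → z.re ≤ b → z ≠ 0 → ‖f z‖ ≤ C * (‖z‖ ^ 2)⁻¹) :
    verticalIntegral a f = verticalIntegral b f := by
  have hint : ∀ c : ℝ, a ≤ c → c ≤ b → c ≠ 0 → VerticalIntegrable c f := by
    intro c h1 h2 h3
    refine verticalIntegrable_of_norm_le (C := C) h3
      (continuous_vertical hf.continuousOn fun z hz => ⟨hz ▸ h1, hz ▸ h2⟩) fun z hz => ?_
    refine hC z (hz ▸ h1) (hz ▸ h2) ?_
    rintro rfl
    exact h3 (by simpa using hz.symm)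
  have hT : Tendsto (fun T : ℝ => T) atTop atTop := tendsto_id
  have hvert : ∀ c : ℝ, a ≤ c → c ≤ b → c ≠ 0 → Tendsto
      (fun T : ℝ => I • ∫ t in (-T)..T, f ((c : ℂ) + (t : ℂ) * I)) atTop
      (𝓝 (verticalIntegral c f)) := by
    intro c h1 h2 h3
    unfold verticalIntegral
    rw [integral_smul]
    exact (intervalIntegral_tendsto_integral (hint c h1 h2 h3) tendsto_neg_atTop_atBot
      hT).const_smul I
  -- The horizontal edges of the rectangle at heights `±T` are treated together through the sign
  -- `s`; each is `O(T⁻²)` over a fixed width.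
  have hhor : ∀ s : ℝ, |s| = 1 →
      Tendsto (fun T : ℝ => ∫ x in a..b, f ((x : ℂ) + ((s * T : ℝ) : ℂ) * I)) atTop (𝓝 0) := by
    intro s hs
    have hs2 : s ^ 2 = 1 := by rw [← sq_abs, hs, one_pow]
    have h0 : Tendsto (fun T : ℝ => C * (T ^ 2)⁻¹ * |b - a|) atTop (𝓝 0) := by
      have : Tendsto (fun T : ℝ => (T ^ 2)⁻¹) atTop (𝓝 0) :=
        tendsto_inv_atTop_zero.comp (tendsto_pow_atTop two_ne_zero)
      simpa using (this.const_mul C).mul_const |b - a|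
    refine squeeze_zero_norm' ?_ h0
    filter_upwards [eventually_gt_atTop 0] with T hTpos
    refine intervalIntegral.norm_integral_le_of_norm_le_const fun x hx => ?_
    rw [Set.uIoc_of_le hab] at hx
    have hne : (x : ℂ) + ((s * T : ℝ) : ℂ) * I ≠ 0 := by
      intro h
      have := congrArg Complex.im h
      simp only [Complex.add_im, Complex.ofReal_im, Complex.mul_im, Complex.ofReal_re,
        Complex.I_im, Complex.I_re, Complex.zero_im] at this
      have h2 : s * T = 0 := by linarith
      rcases mul_eq_zero.mp h2 with h3 | h3
      · rw [h3] at hs2; norm_num at hs2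
      · exact hTpos.ne' h3
    refine (hC _ (by simpa using hx.1.le) (by simpa using hx.2) hne).trans ?_
    rw [norm_sq_vertical, mul_pow, hs2, one_mul]
    have : 0 ≤ x ^ 2 := sq_nonneg x
    gcongr
    linarith
  have hlim := (((hhor (-1) (by simp)).sub (hhor 1 (by simp))).add
    (hvert b hab le_rfl hb)).sub (hvert a le_rfl hab ha)
  have hzero : ∀ T : ℝ, (∫ x in a..b, f ((x : ℂ) + ((-1 * T : ℝ) : ℂ) * I)) -
      (∫ x in a..b, f ((x : ℂ) + ((1 * T : ℝ) : ℂ) * I)) +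
      (I • ∫ t in (-T)..T, f ((b : ℂ) + (t : ℂ) * I)) -
      (I • ∫ t in (-T)..T, f ((a : ℂ) + (t : ℂ) * I)) = 0 := by
    intro T
    have := Complex.integral_boundary_rect_eq_zero_of_differentiableOn f ⟨a, -T⟩ ⟨b, T⟩
      (hf.mono fun z hz => ?_)
    · simpa using this
    · have h1 := hz.1
      simp only [Set.mem_preimage, Set.uIcc_of_le hab] at h1
      exact h1
  simp only [hzero, sub_zero, zero_add] at hlim
  exact (sub_eq_zero.mp (tendsto_nhds_unique hlim tendsto_const_nhds)).symm

/-- Cauchy's theorem for a right half-plane. -/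
theorem verticalIntegral_eq_zero {f : ℂ → E} {a C : ℝ} (ha : 0 < a) (hC0 : 0 ≤ C)
    (hf : DifferentiableOn ℂ f {z | a ≤ z.re})
    (hC : ∀ z : ℂ, a ≤ z.re → ‖f z‖ ≤ C * (‖z‖ ^ 2)⁻¹) : verticalIntegral a f = 0 := by
  -- The line may be moved right to any abscissa `b`, where the integral is at most `C π / b`.
  have hle : ∀ᶠ b : ℝ in atTop, ‖verticalIntegral a f‖ ≤ C * (Real.pi / b) := by
    filter_upwards [eventually_ge_atTop a] with b hb
    rw [verticalIntegral_eq_of_strip ha.ne' (ha.trans_le hb).ne' hb hC0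
      (hf.mono fun z hz => hz.1) fun z h1 _ _ => hC z h1]
    exact norm_verticalIntegral_le (ha.trans_le hb) fun z hz => hC z (hz ▸ hb)
  have h0 : Tendsto (fun b : ℝ => C * (Real.pi / b)) atTop (𝓝 0) := by
    simpa using (tendsto_const_nhds.div_atTop tendsto_id).const_mul C
  exact norm_le_zero_iff.mp (ge_of_tendsto h0 hle)

theorem verticalIntegral_inv_sq_mul_inv_sub {a : ℝ} (ha : 0 < a) {w : ℂ} (hw : w.re < a) :
    verticalIntegral a (fun z : ℂ => 1 / z ^ 2 * (z - w)⁻¹) = 0 := by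
  have hne : ∀ z : ℂ, a ≤ z.re → z ≠ 0 ∧ z - w ≠ 0 := by
    intro z hz
    constructor
    · rintro rfl
      simp only [Complex.zero_re] at hz
      linarith
    · intro h
      have := congrArg Complex.re h
      simp only [Complex.sub_re, Complex.zero_re] at this
      linarith
  refine verticalIntegral_eq_zero (C := (a - w.re)⁻¹) ha (inv_nonneg.mpr (by linarith)) ?_ ?_
  · intro z hz
    obtain ⟨h1, h2⟩ := hne z hz
    have h3 : z ^ 2 ≠ 0 := pow_ne_zero 2 h1
    apply DifferentiableAt.differentiableWithinAt
    fun_prop (disch := assumption)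
  · intro z hz
    rw [norm_mul, norm_inv, norm_div, norm_one, norm_pow, mul_comm, one_div]
    have h1 : a - w.re ≤ ‖z - w‖ :=
      le_trans (by simp only [Complex.sub_re]; linarith [show a ≤ z.re from hz])
        (Complex.re_le_norm (z - w))
    gcongr

theorem verticalIntegral_inv_sq {a : ℝ} (ha : 0 < a) :
    verticalIntegral a (fun z : ℂ => 1 / z ^ 2) = 0 := by
  refine verticalIntegral_eq_zero (C := 1) ha zero_le_one ?_ ?_
  · intro z hz
    have h1 : z ^ 2 ≠ 0 := by
      apply pow_ne_zero
      rintro rfl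
      have : a ≤ 0 := hz
      linarith
    apply DifferentiableAt.differentiableWithinAt
    fun_prop (disch := assumption)
  · intro z _
    simp

theorem verticalIntegral_neg_inv_sq {a : ℝ} (ha : 0 < a) :
    verticalIntegral (-a) (fun z : ℂ => 1 / z ^ 2) = 0 := by
  rw [verticalIntegral_neg]
  simpa using verticalIntegral_inv_sq ha

/-- The point `-2a` is the mirror image of `0` in the line `Re z = -a`, so points to the right of
that line are nearer to `0`. -/
theorem norm_le_norm_add_two_mul {a : ℝ} {z : ℂ} (ha : 0 ≤ a) (h : -a ≤ z.re) :
    ‖z‖ ≤ ‖z + 2 * (a : ℂ)‖ := by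
  rw [Complex.norm_eq_sqrt_sq_add_sq, Complex.norm_eq_sqrt_sq_add_sq]
  apply Real.sqrt_le_sqrt
  have h1 : (z + 2 * (a : ℂ)).re = z.re + 2 * a := by simp
  have h2 : (z + 2 * (a : ℂ)).im = z.im := by simp
  rw [h1, h2]
  nlinarith [mul_nonneg ha (show 0 ≤ z.re + a by linarith)]

theorem verticalIntegral_inv_mul_add {a : ℝ} (ha : 0 < a) :
    verticalIntegral a (fun z : ℂ => z⁻¹ * (z + 2 * (a : ℂ))⁻¹) = 0 := by
  refine verticalIntegral_eq_zero (C := 1) ha zero_le_one ?_ ?_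
  · intro z hz
    have hz' : a ≤ z.re := hz
    have h1 : z ≠ 0 := by
      rintro rfl
      simp only [Complex.zero_re] at hz'
      linarith
    have h2 : z + 2 * (a : ℂ) ≠ 0 := by
      intro h
      have := congrArg Complex.re h
      simp at this
      linarith
    apply DifferentiableAt.differentiableWithinAt
    fun_prop (disch := assumption)
  · intro z hz
    have h1 : 0 < ‖z‖ := norm_pos_iff.mpr (by rintro rfl; simp at hz; linarith)
    rw [norm_mul, norm_inv, norm_inv, one_mul, sq, mul_inv]
    gcongr
    exact norm_le_norm_add_two_mul ha.le (by linarith [show a ≤ z.re from hz])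

/-- The line runs midway between the poles `0` and `-2a`, so the denominator is the real number
`-(a² + t²)`. This explicit integral plays the role of the residue at `0`. -/
theorem verticalIntegral_neg_inv_mul_add {a : ℝ} (ha : 0 < a) :
    verticalIntegral (-a) (fun z : ℂ => z⁻¹ * (z + 2 * (a : ℂ))⁻¹) = -(Real.pi / a) * I := by
  have h1 : ∀ t : ℝ, I • ((((-a : ℝ) : ℂ) + (t : ℂ) * I)⁻¹ *
      (((-a : ℝ) : ℂ) + (t : ℂ) * I + 2 * (a : ℂ))⁻¹) = ((a ^ 2 + t ^ 2)⁻¹ : ℝ) • (-I) := by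
    intro t
    rw [← mul_inv, Complex.real_smul, smul_eq_mul]
    push_cast
    rw [show (-(a : ℂ) + t * I) * (-(a : ℂ) + t * I + 2 * a) = -((a : ℂ) ^ 2 + t ^ 2) by
      linear_combination (t : ℂ) ^ 2 * Complex.I_sq]
    rw [inv_neg]
    ring
  unfold verticalIntegral
  simp only [h1]
  rw [integral_smul_const, integral_univ_inv_sq_add_sq ha, Complex.real_smul]
  push_cast
  ring

theorem verticalIntegral_smul_const [CompleteSpace E] {a : ℝ} (f : ℂ → ℂ) (x : E) :
    verticalIntegral a (fun z => f z • x) = verticalIntegral a f • x := by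
  unfold verticalIntegral
  rw [← integral_smul_const]
  simp only [smul_smul, smul_eq_mul]

theorem verticalIntegral_sub {a : ℝ} {f g : ℂ → E} (hf : VerticalIntegrable a f)
    (hg : VerticalIntegrable a g) :
    verticalIntegral a (fun z => f z - g z) = verticalIntegral a f - verticalIntegral a g := by
  unfold verticalIntegral
  simp only [smul_sub]
  exact integral_sub (hf.smul I) (hg.smul I)

theorem verticalIntegral_add {a : ℝ} {f g : ℂ → E} (hf : VerticalIntegrable a f)
    (hg : VerticalIntegrable a g) :
    verticalIntegral a (fun z => f z + g z) = verticalIntegral a f + verticalIntegral a g := by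
  unfold verticalIntegral
  simp only [smul_add]
  exact integral_add (hf.smul I) (hg.smul I)

theorem verticalIntegral_clm_comp {F : Type*} [NormedAddCommGroup F] [NormedSpace ℂ F]
    [CompleteSpace E] [CompleteSpace F] {a : ℝ} {f : ℂ → E} (hf : VerticalIntegrable a f)
    (L : E →L[ℂ] F) : verticalIntegral a (fun z => L (f z)) = L (verticalIntegral a f) := by
  unfold verticalIntegral
  have h1 : Integrable fun t : ℝ => I • f ((a : ℂ) + (t : ℂ) * I) := hf.smul I
  rw [← L.integral_comp_comm h1]
  simp

theorem verticalIntegral_congr {a : ℝ} {f g : ℂ → E} (h : ∀ z : ℂ, z.re = a → f z = g z) :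
    verticalIntegral a f = verticalIntegral a g := by
  unfold verticalIntegral
  congr 1
  funext t
  rw [h _ (by simp)]

end VerticalIntegral

section VerticalIntegralMul

variable {A : Type*} [NormedRing A] [NormedAlgebra ℂ A] [CompleteSpace A]

theorem verticalIntegral_const_mul {a : ℝ} {f : ℂ → A} (hf : VerticalIntegrable a f) (T : A) :
    verticalIntegral a (fun z => T * f z) = T * verticalIntegral a f :=
  verticalIntegral_clm_comp hf (ContinuousLinearMap.mul ℂ A T)

theorem verticalIntegral_mul_const {a : ℝ} {f : ℂ → A} (hf : VerticalIntegrable a f) (T : A) :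
    verticalIntegral a (fun z => f z * T) = verticalIntegral a f * T :=
  verticalIntegral_clm_comp hf ((ContinuousLinearMap.mul ℂ A).flip T)

theorem commute_verticalIntegral {a : ℝ} {f : ℂ → A} (hf : VerticalIntegrable a f) {T : A}
    (h : ∀ z : ℂ, z.re = a → Commute T (f z)) : Commute T (verticalIntegral a f) := by
  unfold Commute SemiconjBy
  rw [← verticalIntegral_const_mul hf, ← verticalIntegral_mul_const hf]
  exact verticalIntegral_congr fun z hz => h z hz

end VerticalIntegralMul

namespace LinearPMap

/-! ### Bounded resolvent on a strip; the sum `A₊ + A₋`. -/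

section Strip

open Complex (I)

variable {X : Type*} [NormedAddCommGroup X] [NormedSpace ℂ X] {S : X →ₗ.[ℂ] X} {h M : ℝ}

/-- The strip `|Re z| ≤ h` lies in `ϱ(S)`, and the resolvent is bounded by `M` there. -/
structure IsStripBounded (S : X →ₗ.[ℂ] X) (h M : ℝ) : Prop where
  pos : 0 < h
  subset : {z : ℂ | |z.re| ≤ h} ⊆ S.resolventSet
  bound : ∀ z : ℂ, |z.re| ≤ h → ‖S.resolventOp z‖ ≤ M

namespace IsStripBounded

theorem neg (H : S.IsStripBounded h M) : (-S).IsStripBounded h M where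
  pos := H.pos
  subset z hz := mem_resolventSet_neg_iff.mpr (H.subset (by simpa using hz))
  bound z hz := by
    rw [resolventOp_neg, norm_neg]
    exact H.bound _ (by simpa using hz)

theorem mem (H : S.IsStripBounded h M) {z : ℂ} (hz : |z.re| ≤ h) : z ∈ S.resolventSet :=
  H.subset hz

theorem zero_mem (H : S.IsStripBounded h M) : (0 : ℂ) ∈ S.resolventSet :=
  H.mem (by simpa using H.pos.le)

theorem isResolventAt_zero (H : S.IsStripBounded h M) : S.IsResolventAt 0 (S.resolventOp 0) :=
  isResolventAt_resolventOp H.zero_mem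

theorem bound_nonneg (H : S.IsStripBounded h M) : 0 ≤ M :=
  (norm_nonneg _).trans (H.bound 0 (by simpa using H.pos.le))

theorem resolventOp_eq (H : S.IsStripBounded h M) {z : ℂ} (hz : z ∈ S.resolventSet) :
    S.resolventOp z = S.resolventOp 0 + z • (S.resolventOp 0 * S.resolventOp z) := by
  simpa using (isResolventAt_resolventOp hz).identity H.isResolventAt_zero

theorem abs_self_le (H : S.IsStripBounded h M) : |h| ≤ h := (abs_of_pos H.pos).le

theorem commute_resolventOp {z w : ℂ} (hz : z ∈ S.resolventSet) (hw : w ∈ S.resolventSet) :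
    Commute (S.resolventOp z) (S.resolventOp w) :=
  (isResolventAt_resolventOp hz).commute (isResolventAt_resolventOp hw)

theorem Aminus_eq (S : X →ₗ.[ℂ] X) (h : ℝ) : S.Aminus h = (-S).Aplus h := by
  unfold Aminus Aplus
  rw [verticalIntegral_neg]
  simp only [resolventOp_neg, smul_neg, even_two, Even.neg_pow]
  have : verticalIntegral h (fun z : ℂ => -((1 / z ^ 2) • S.resolventOp (-z))) =
      -verticalIntegral h (fun z : ℂ => (1 / z ^ 2) • S.resolventOp (-z)) := by
    unfold verticalIntegral
    simp only [smul_neg, integral_neg]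
  rw [this, smul_neg, neg_div, neg_smul]

variable [CompleteSpace X]

theorem continuousOn (H : S.IsStripBounded h M) :
    ContinuousOn S.resolventOp {z : ℂ | |z.re| ≤ h} :=
  (S.analyticOnNhd_resolventOp.continuousOn).mono H.subset

theorem verticalIntegrable_smul (H : S.IsStripBounded h M) {a C : ℝ} (ha : a ≠ 0) (hah : |a| ≤ h)
    {g : ℂ → ℂ} (hg : Continuous fun t : ℝ => g ((a : ℂ) + (t : ℂ) * I))
    (hC : ∀ z : ℂ, z.re = a → ‖g z‖ ≤ C * (‖z‖ ^ 2)⁻¹) :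
    VerticalIntegrable a fun z => g z • S.resolventOp z := by
  refine verticalIntegrable_of_norm_le (C := C * M) ha
    (hg.smul (continuous_vertical H.continuousOn fun z hz => by simpa [hz] using hah))
    fun z hz => ?_
  rw [norm_smul, mul_right_comm]
  have h1 := hC z hz
  exact mul_le_mul h1 (H.bound z (by rwa [hz])) (norm_nonneg _) ((norm_nonneg _).trans h1)

theorem continuous_inv_sq {a : ℝ} (ha : a ≠ 0) :
    Continuous fun t : ℝ => 1 / ((a : ℂ) + (t : ℂ) * I) ^ 2 :=
  continuous_const.div (by fun_prop) fun t => pow_ne_zero 2 (vertical_ne_zero ha t)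

theorem verticalIntegrable (H : S.IsStripBounded h M) {a : ℝ} (ha : a ≠ 0) (hah : |a| ≤ h) :
    VerticalIntegrable a fun z => (1 / z ^ 2) • S.resolventOp z :=
  H.verticalIntegrable_smul (C := 1) ha hah (continuous_inv_sq ha) fun z _ => by simp

theorem verticalIntegrable_apply (H : S.IsStripBounded h M) {a : ℝ} (ha : a ≠ 0)
    (hah : |a| ≤ h) (x : X) :
    VerticalIntegrable a fun z => (1 / z ^ 2) • S.resolventOp z x :=
  (ContinuousLinearMap.apply ℂ X x).integrable_comp (H.verticalIntegrable ha hah)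

theorem Aplus_apply (H : S.IsStripBounded h M) (x : X) :
    S.Aplus h x = (1 / (2 * (Real.pi : ℂ) * I)) •
      verticalIntegral h fun z : ℂ => (1 / z ^ 2) • S.resolventOp z x := by
  have := verticalIntegral_clm_comp (H.verticalIntegrable H.pos.ne' H.abs_self_le)
    (ContinuousLinearMap.apply ℂ X x)
  simp only [ContinuousLinearMap.apply_apply, _root_.smul_apply] at this
  rw [Aplus, _root_.smul_apply, this]

theorem commute_Aplus (H : S.IsStripBounded h M) {T : X →L[ℂ] X}
    (hT : ∀ z : ℂ, |z.re| ≤ h → Commute T (S.resolventOp z)) : Commute T (S.Aplus h) :=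
  (commute_verticalIntegral (H.verticalIntegrable H.pos.ne' H.abs_self_le)
    fun z hz => (hT z (by rw [hz]; exact H.abs_self_le)).smul_right _).smul_right _

theorem commute_resolventOp_Aplus (H : S.IsStripBounded h M) {z : ℂ} (hz : z ∈ S.resolventSet) :
    Commute (S.resolventOp z) (S.Aplus h) :=
  H.commute_Aplus fun _ hw => commute_resolventOp hz (H.mem hw)

/-- `A₊ + A₋ = S⁻²`. -/
theorem Aplus_add_Aminus (H : S.IsStripBounded h M) :
    S.Aplus h + S.Aminus h = S.resolventOp 0 * S.resolventOp 0 := by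
  set R := S.resolventOp
  have hpos := H.pos
  have hmem : ∀ z : ℂ, |z.re| ≤ h → z + 2 * (h : ℂ) ≠ 0 := by
    intro z hz e
    have := congrArg Complex.re e
    simp at this
    linarith [(abs_le.mp hz).1]
  -- `f` is `z⁻² R z` with its pole at `0` removed. The term `z⁻¹ R(0)²` decays too slowly to
  -- integrate along the line, so `2h / (z (z + 2h))` is subtracted in its place: it has the same
  -- residue at `0`, decays like `|z|⁻²`, and its other pole `-2h` lies outside the strip.
  let f : ℂ → X →L[ℂ] X := fun z => R 0 * R 0 * R z + (z + 2 * (h : ℂ))⁻¹ • (R 0 * R 0)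
  let g₁ : ℂ → X →L[ℂ] X := fun z => (1 / z ^ 2) • R z
  let g₂ : ℂ → X →L[ℂ] X := fun z => (1 / z ^ 2) • R 0
  let g₃ : ℂ → X →L[ℂ] X := fun z =>
    (z⁻¹ * (z + 2 * (h : ℂ))⁻¹) • ((2 * (h : ℂ)) • (R 0 * R 0))
  have hf : ∀ z : ℂ, |z.re| ≤ h → z ≠ 0 → f z = g₁ z - g₂ z - g₃ z := by
    intro z hz hz0
    have e1 : R z = R 0 + z • (R 0 * R z) := H.resolventOp_eq (H.mem hz)
    -- The resolvent identity applied twice: a second-order Taylor expansion at `0` with exact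
    -- remainder.
    have e2 : R z = R 0 + z • (R 0 * R 0) + z ^ 2 • (R 0 * R 0 * R z) := by
      conv_lhs => rw [e1, e1]
      simp only [mul_add, mul_smul_comm, smul_add, smul_smul, mul_assoc]
      ring_nf
      module
    have hz2 := hmem z hz
    have e3 : g₁ z = (1 / z ^ 2) • R 0 + (1 / z ^ 2 * z) • (R 0 * R 0) +
        R 0 * R 0 * R z := by
      simp only [g₁]
      conv_lhs => rw [e2]
      rw [smul_add, smul_add, smul_smul, smul_smul, one_div_mul_cancel (pow_ne_zero 2 hz0),
        one_smul]
    rw [e3]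
    have e4 : 1 / z ^ 2 * z - z⁻¹ * (z + 2 * (h : ℂ))⁻¹ * (2 * (h : ℂ)) =
        (z + 2 * (h : ℂ))⁻¹ := by
      field_simp
      ring
    have e5 : f z = R 0 * R 0 * R z + (1 / z ^ 2 * z -
        z⁻¹ * (z + 2 * (h : ℂ))⁻¹ * (2 * (h : ℂ))) • (R 0 * R 0) := by rw [e4]
    rw [e5]
    simp only [g₂, g₃]
    module
  have hC : ∀ z : ℂ, |z.re| ≤ h → z ≠ 0 →
      ‖f z‖ ≤ (M + M + 2 * h * (M * M)) * (‖z‖ ^ 2)⁻¹ := by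
    intro z hz hz0
    rw [hf z hz hz0]
    have hM := H.bound_nonneg
    have h0 : ‖R 0‖ ≤ M := H.bound 0 (by simpa using H.pos.le)
    have b1 : ‖g₁ z‖ ≤ M * (‖z‖ ^ 2)⁻¹ := by
      simp only [g₁, norm_smul, one_div, norm_inv, norm_pow]
      rw [mul_comm]
      gcongr
      exact H.bound z hz
    have b2 : ‖g₂ z‖ ≤ M * (‖z‖ ^ 2)⁻¹ := by
      simp only [g₂, norm_smul, one_div, norm_inv, norm_pow]
      rw [mul_comm]
      gcongr
    have b3 : ‖g₃ z‖ ≤ 2 * h * (M * M) * (‖z‖ ^ 2)⁻¹ := by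
      simp only [g₃, norm_smul, norm_mul, norm_inv, Complex.norm_real, Complex.norm_ofNat,
        Real.norm_of_nonneg hpos.le]
      rw [mul_comm, sq, mul_inv]
      have hzp : 0 < ‖z‖ := norm_pos_iff.mpr hz0
      have := norm_le_norm_add_two_mul hpos.le (abs_le.mp hz).1
      gcongr
      exact (norm_mul_le _ _).trans (by gcongr)
    calc ‖g₁ z - g₂ z - g₃ z‖ ≤ ‖g₁ z‖ + ‖g₂ z‖ + ‖g₃ z‖ :=
          (norm_sub_le _ _).trans (by gcongr; exact norm_sub_le _ _)
      _ ≤ _ := by linarith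
  have hd : DifferentiableOn ℂ f {z : ℂ | -h ≤ z.re ∧ z.re ≤ h} := by
    intro z hz
    have hz' : |z.re| ≤ h := abs_le.mpr hz
    have h1 : DifferentiableAt ℂ R z :=
      (S.analyticOnNhd_resolventOp z (H.mem hz')).differentiableAt
    have h2 := hmem z hz'
    apply DifferentiableAt.differentiableWithinAt
    exact (h1.const_mul _).add (DifferentiableAt.smul_const
      (by fun_prop (disch := assumption)) _)
  have hsplit : ∀ a : ℝ, a ≠ 0 → |a| ≤ h → verticalIntegral a f =
      verticalIntegral a g₁ - verticalIntegral a (fun z : ℂ => 1 / z ^ 2) • R 0 -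
        verticalIntegral a (fun z : ℂ => z⁻¹ * (z + 2 * (h : ℂ))⁻¹) •
          ((2 * (h : ℂ)) • (R 0 * R 0)) := by
    intro a ha hah
    have j2 : verticalIntegral a g₂ = verticalIntegral a (fun z : ℂ => 1 / z ^ 2) • R 0 :=
      verticalIntegral_smul_const _ _
    have j3 : verticalIntegral a g₃ =
        verticalIntegral a (fun z : ℂ => z⁻¹ * (z + 2 * (h : ℂ))⁻¹) •
          ((2 * (h : ℂ)) • (R 0 * R 0)) := verticalIntegral_smul_const _ _
    rw [← j2, ← j3]
    have hz : ∀ z : ℂ, z.re = a → |z.re| ≤ h ∧ z ≠ 0 := by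
      intro z hz
      refine ⟨by rwa [hz], ?_⟩
      rintro rfl
      exact ha (by simpa using hz.symm)
    have i1 : VerticalIntegrable a g₁ := H.verticalIntegrable ha hah
    have i2 : VerticalIntegrable a g₂ := by
      refine verticalIntegrable_of_norm_le (C := ‖R 0‖) ha
        ((continuous_inv_sq ha).smul continuous_const) fun z _ => ?_
      simp [g₂, norm_smul, mul_comm]
    have i3 : VerticalIntegrable a g₃ := by
      refine verticalIntegrable_of_norm_le (C := ‖(2 * (h : ℂ)) • (R 0 * R 0)‖) ha ?_ ?_
      · simp only [g₃]
        refine Continuous.fun_smul (Continuous.fun_mul ?_ ?_) continuous_const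
        · exact Continuous.inv₀ (by fun_prop) (vertical_ne_zero ha)
        · exact Continuous.inv₀ (by fun_prop) fun t => hmem _ (by simpa using hah)
      · intro z hza
        have hzp : 0 < ‖z‖ := norm_pos_iff.mpr (hz z hza).2
        have := norm_le_norm_add_two_mul hpos.le (abs_le.mp (hz z hza).1).1
        simp only [g₃]
        rw [norm_smul, mul_comm, norm_mul, norm_inv, norm_inv, sq, mul_inv]
        gcongr
    have i12 : VerticalIntegrable a fun z => g₁ z - g₂ z := i1.sub i2
    rw [← verticalIntegral_sub i1 i2, ← verticalIntegral_sub i12 i3]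
    exact verticalIntegral_congr fun z hza => hf z (hz z hza).1 (hz z hza).2
  -- Comparing the lines `Re z = ±h` for the holomorphic `f`, only `g₁` and the explicit integral of
  -- `g₃` on the left line survive.
  have key := verticalIntegral_eq_of_strip (a := -h) (b := h) (neg_ne_zero.mpr hpos.ne') hpos.ne'
    (by linarith) (by have := H.bound_nonneg; positivity) hd
    fun z h1 h2 h3 => hC z (abs_le.mpr ⟨h1, h2⟩) h3
  rw [hsplit h hpos.ne' H.abs_self_le, hsplit (-h) (neg_ne_zero.mpr hpos.ne')
    (by rw [abs_neg]; exact H.abs_self_le), verticalIntegral_inv_sq hpos,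
    verticalIntegral_neg_inv_sq hpos, verticalIntegral_inv_mul_add hpos,
    verticalIntegral_neg_inv_mul_add hpos] at key
  simp only [zero_smul, sub_zero] at key
  have e : S.Aplus h + S.Aminus h = (1 / (2 * (Real.pi : ℂ) * I)) •
      (verticalIntegral h g₁ - verticalIntegral (-h) g₁) := by
    rw [Aplus, Aminus, smul_sub, neg_div, neg_smul, ← sub_eq_add_neg]
  rw [e, ← key, sub_sub_cancel_left, smul_smul, ← neg_smul, smul_smul]
  have hp : (Real.pi : ℂ) ≠ 0 := by exact_mod_cast Real.pi_ne_zero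
  have hh : (h : ℂ) ≠ 0 := by exact_mod_cast hpos.ne'
  have : 1 / (2 * (Real.pi : ℂ) * I) * -(-(Real.pi / h) * I * (2 * (h : ℂ))) = 1 := by
    field_simp
  rw [this, one_smul]

end IsStripBounded

end Strip

end LinearPMap

namespace LinearPMap

/-! ### Analytic extensions, the spaces `G₊` and `G₋`, and the products of `A₊` and `A₋`. -/

section Extension

open Complex (I)

variable {X : Type*} [NormedAddCommGroup X] [NormedSpace ℂ X] {S : X →ₗ.[ℂ] X} {h M : ℝ}

/-- The Cauchy integral `(1 / 2πi) ∫_{h - i∞}^{h + i∞} w⁻² (w - z)⁻¹ (S - w)⁻¹ dw`, an extension of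
`z ↦ (S - z)⁻¹ A₊` to the half-plane `Re z < h`. -/
noncomputable def leftExtension (S : X →ₗ.[ℂ] X) (h : ℝ) (z : ℂ) : X →L[ℂ] X :=
  (1 / (2 * (Real.pi : ℂ) * I)) •
    verticalIntegral h fun w : ℂ => (1 / w ^ 2 * (w - z)⁻¹) • S.resolventOp w

namespace IsStripBounded

theorem norm_inv_sub_le {z w : ℂ} {d : ℝ} (hd : 0 < d) (hzw : z.re + d ≤ w.re) :
    ‖(w - z)⁻¹‖ ≤ d⁻¹ := by
  rw [norm_inv]
  gcongr
  refine le_trans ?_ (Complex.re_le_norm (w - z))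
  simp only [Complex.sub_re]
  linarith

theorem sub_ne_zero_of_re_lt {z w : ℂ} (hzw : z.re < w.re) : w - z ≠ 0 := by
  intro e
  have := congrArg Complex.re e
  simp only [Complex.sub_re, Complex.zero_re] at this
  linarith

/-- The exponent `n` is `1` for the kernel itself and `2` for its derivative in `z`. -/
theorem continuous_cauchyKernel (hpos : 0 < h) {z : ℂ} (hz : z.re < h) (n : ℕ) :
    Continuous fun t : ℝ => 1 / ((h : ℂ) + (t : ℂ) * I) ^ 2 *
      (((h : ℂ) + (t : ℂ) * I - z)⁻¹) ^ n :=
  (continuous_inv_sq hpos.ne').mul ((Continuous.inv₀ (by fun_prop)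
    fun t => sub_ne_zero_of_re_lt (by simpa using hz)).pow n)

theorem norm_cauchyKernel_le {z w : ℂ} {d : ℝ} (hd : 0 < d) (hzw : z.re + d ≤ w.re) (n : ℕ) :
    ‖1 / w ^ 2 * ((w - z)⁻¹) ^ n‖ ≤ d⁻¹ ^ n * (‖w‖ ^ 2)⁻¹ := by
  rw [norm_mul, norm_pow, one_div, norm_inv, norm_pow, mul_comm]
  gcongr
  exact norm_inv_sub_le hd hzw

theorem norm_leftExtension_le (H : S.IsStripBounded h M) :
    ∃ K : ℝ, ∀ z : ℂ, z.re ≤ 0 → ‖S.leftExtension h z‖ ≤ K := by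
  refine ⟨‖1 / (2 * (Real.pi : ℂ) * I)‖ * (h⁻¹ * M * (Real.pi / h)), fun z hz => ?_⟩
  rw [leftExtension, norm_smul]
  refine mul_le_mul_of_nonneg_left (norm_verticalIntegral_le H.pos fun w hw => ?_) (norm_nonneg _)
  rw [norm_smul, mul_right_comm]
  have h1 := norm_cauchyKernel_le (z := z) (w := w) (d := h) H.pos (by linarith) 1
  simp only [pow_one] at h1
  exact mul_le_mul h1 (H.bound w (by rw [hw]; exact H.abs_self_le)) (norm_nonneg _)
    ((norm_nonneg _).trans h1)

variable [CompleteSpace X]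

theorem verticalIntegrable_cauchyKernel (H : S.IsStripBounded h M) {z : ℂ} (hz : z.re < h) :
    VerticalIntegrable h fun w : ℂ => (1 / w ^ 2 * (w - z)⁻¹) • S.resolventOp w := by
  have h1 := continuous_cauchyKernel H.pos hz 1
  simp only [pow_one] at h1
  refine H.verticalIntegrable_smul (g := fun w : ℂ => 1 / w ^ 2 * (w - z)⁻¹)
    (C := (h - z.re)⁻¹) H.pos.ne' H.abs_self_le h1 fun w hw => ?_
  simpa only [pow_one] using
    norm_cauchyKernel_le (z := z) (w := w) (d := h - z.re) (by linarith) (by linarith) 1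

theorem differentiableAt_leftExtension (H : S.IsStripBounded h M) {z : ℂ} (hz : z.re < h) :
    DifferentiableAt ℂ (S.leftExtension h) z := by
  -- With half the distance to the line, `Re w < h - d` is a neighbourhood of `z` on which the
  -- kernel's derivative has one integrable bound.
  set d : ℝ := (h - z.re) / 2 with hd
  have hdpos : 0 < d := by rw [hd]; linarith
  have hRc : Continuous fun t : ℝ => S.resolventOp ((h : ℂ) + (t : ℂ) * I) :=
    continuous_vertical H.continuousOn fun w hw => by
      simpa only [Set.mem_ofPred_eq, hw] using H.abs_self_le
  have hs : {w : ℂ | w.re < h - d} ∈ 𝓝 z :=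
    (isOpen_lt Complex.continuous_re continuous_const).mem_nhds
      (show z.re < h - d by rw [hd]; linarith)
  suffices hv : DifferentiableAt ℂ (fun z : ℂ => verticalIntegral h fun w : ℂ =>
      (1 / w ^ 2 * (w - z)⁻¹) • S.resolventOp w) z from
      hv.const_smul (1 / (2 * (Real.pi : ℂ) * I))
  refine (hasDerivAt_integral_of_dominated_loc_of_deriv_le
    (F := fun (w : ℂ) (t : ℝ) => I • ((1 / ((h : ℂ) + (t : ℂ) * I) ^ 2 *
      ((h : ℂ) + (t : ℂ) * I - w)⁻¹) • S.resolventOp ((h : ℂ) + (t : ℂ) * I)))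
    (F' := fun (w : ℂ) (t : ℝ) => I • ((1 / ((h : ℂ) + (t : ℂ) * I) ^ 2 *
      (((h : ℂ) + (t : ℂ) * I - w)⁻¹) ^ 2) • S.resolventOp ((h : ℂ) + (t : ℂ) * I)))
    (bound := fun t => d⁻¹ ^ 2 * M * (h ^ 2 + t ^ 2)⁻¹) hs ?_ ?_ ?_ ?_ ?_ ?_).2.differentiableAt
  · filter_upwards [hs] with w hw
    have h1 := continuous_cauchyKernel H.pos (z := w)
      (by linarith [show w.re < h - d from hw]) 1
    simp only [pow_one] at h1
    exact ((h1.smul hRc).const_smul I).aestronglyMeasurable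
  · exact (H.verticalIntegrable_cauchyKernel hz).smul I
  · exact (((continuous_cauchyKernel H.pos hz 2).smul hRc).const_smul I).aestronglyMeasurable
  · refine Eventually.of_forall fun t w hw => ?_
    rw [norm_smul, Complex.norm_I, one_mul, norm_smul, mul_right_comm, ← norm_sq_vertical]
    have h1 := norm_cauchyKernel_le (z := w) (w := (h : ℂ) + (t : ℂ) * I) (d := d) hdpos
      (by simp; linarith [show w.re < h - d from hw]) 2
    exact mul_le_mul h1 (H.bound _ (by simpa using H.abs_self_le)) (norm_nonneg _)
      ((norm_nonneg _).trans h1)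
  · exact (integrable_inv_sq_add_sq H.pos.ne').const_mul _
  · refine Eventually.of_forall fun t w hw => ?_
    have hne : (h : ℂ) + (t : ℂ) * I - w ≠ 0 :=
      sub_ne_zero_of_re_lt (by simp; linarith [show w.re < h - d from hw])
    have h1 : HasDerivAt (fun w : ℂ => ((h : ℂ) + (t : ℂ) * I - w)⁻¹)
        ((((h : ℂ) + (t : ℂ) * I - w)⁻¹) ^ 2) w := by
      have := ((hasDerivAt_id' w).const_sub ((h : ℂ) + (t : ℂ) * I)).fun_inv hne
      rwa [neg_neg, one_div, ← inv_pow] at this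
    exact ((h1.const_mul (1 / ((h : ℂ) + (t : ℂ) * I) ^ 2)).smul_const
      (S.resolventOp ((h : ℂ) + (t : ℂ) * I))).fun_const_smul I

theorem commute_leftExtension (H : S.IsStripBounded h M) {T : X →L[ℂ] X}
    (hT : ∀ z : ℂ, |z.re| ≤ h → Commute T (S.resolventOp z)) {z : ℂ} (hz : z.re < h) :
    Commute T (S.leftExtension h z) :=
  (commute_verticalIntegral (H.verticalIntegrable_cauchyKernel hz)
    fun w hw => (hT w (by rw [hw]; exact H.abs_self_le)).smul_right _).smul_right _

/-- By the resolvent identity, `(1 - z R(0)) R(w) = R(0) + (w - z) R(0) R(w)`. Against the Cauchy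
kernel the first term integrates to zero, both poles lying left of the line, and in the second the
factor `w - z` cancels. No condition `z ∈ ϱ(S)` enters. -/
theorem one_sub_mul_leftExtension (H : S.IsStripBounded h M) {z : ℂ} (hz : z.re < h) :
    (1 - z • S.resolventOp 0) * S.leftExtension h z = S.resolventOp 0 * S.Aplus h := by
  have i1 := H.verticalIntegrable_cauchyKernel hz
  have i2 := H.verticalIntegrable H.pos.ne' H.abs_self_le
  have i3 : VerticalIntegrable h fun w : ℂ => (1 / w ^ 2 * (w - z)⁻¹) • S.resolventOp 0 := by
    have h1 := continuous_cauchyKernel H.pos hz 1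
    simp only [pow_one] at h1
    refine verticalIntegrable_of_norm_le (C := (h - z.re)⁻¹ * M) H.pos.ne'
      (h1.smul continuous_const) fun w hw => ?_
    have h2 := norm_cauchyKernel_le (z := z) (w := w) (d := h - z.re) (by linarith)
      (by linarith) 1
    simp only [pow_one] at h2
    rw [norm_smul, mul_right_comm]
    exact mul_le_mul h2 (H.bound 0 (by simpa using H.pos.le)) (norm_nonneg _)
      ((norm_nonneg _).trans h2)
  have i4 : VerticalIntegrable h fun w : ℂ =>
      S.resolventOp 0 * ((1 / w ^ 2) • S.resolventOp w) := i2.const_mul _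
  rw [leftExtension, Aplus, mul_smul_comm, mul_smul_comm, ← verticalIntegral_const_mul i1,
    ← verticalIntegral_const_mul i2]
  congr 1
  have e : verticalIntegral h (fun w : ℂ => (1 / w ^ 2 * (w - z)⁻¹) • S.resolventOp 0) = 0 := by
    rw [verticalIntegral_smul_const (fun w : ℂ => 1 / w ^ 2 * (w - z)⁻¹) (S.resolventOp 0),
      verticalIntegral_inv_sq_mul_inv_sub H.pos hz, zero_smul]
  rw [← zero_add (verticalIntegral h fun w => S.resolventOp 0 * _), ← e,
    ← verticalIntegral_add i3 i4]
  refine verticalIntegral_congr fun w hw => ?_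
  have hne : w - z ≠ 0 := sub_ne_zero_of_re_lt (by rwa [hw])
  have e1 := H.resolventOp_eq (z := w) (H.mem (by rw [hw]; exact H.abs_self_le))
  have e2 : (1 - z • S.resolventOp 0) * S.resolventOp w =
      S.resolventOp 0 + (w - z) • (S.resolventOp 0 * S.resolventOp w) := by
    rw [sub_mul, one_mul, smul_mul_assoc]
    nth_rw 1 [e1]
    module
  rw [mul_smul_comm, e2, smul_add, smul_smul, mul_assoc, inv_mul_cancel₀ hne, mul_one,
    mul_smul_comm]

/-- For `z ∈ ϱ(S)` the factor `1 - z R(0)` has the left inverse `1 + z R(z)`, which turns `R(0) A₊`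
into `R(z) A₊`. -/
theorem leftExtension_eq (H : S.IsStripBounded h M) {z : ℂ} (hz : z.re < h)
    (hzS : z ∈ S.resolventSet) :
    S.leftExtension h z = S.resolventOp z * S.Aplus h := by
  have e1 := H.resolventOp_eq hzS
  have hc : S.resolventOp z * S.resolventOp 0 = S.resolventOp 0 * S.resolventOp z :=
    commute_resolventOp hzS H.zero_mem
  have e2 : (1 + z • S.resolventOp z) * (1 - z • S.resolventOp 0) = 1 := by
    simp only [add_mul, mul_sub, one_mul, mul_one, smul_mul_assoc, mul_smul_comm, hc]
    nth_rw 1 [e1]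
    module
  have e3 : (1 + z • S.resolventOp z) * S.resolventOp 0 = S.resolventOp z := by
    rw [add_mul, one_mul, smul_mul_assoc, hc]
    exact e1.symm
  calc S.leftExtension h z
      = (1 + z • S.resolventOp z) * ((1 - z • S.resolventOp 0) * S.leftExtension h z) := by
        rw [← mul_assoc, e2, one_mul]
    _ = S.resolventOp z * S.Aplus h := by
        rw [H.one_sub_mul_leftExtension hz, ← mul_assoc, e3]

theorem analyticAt_leftExtension (H : S.IsStripBounded h M) {z : ℂ} (hz : z.re < h) :
    AnalyticAt ℂ (S.leftExtension h) z := by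
  rw [Complex.analyticAt_iff_eventually_differentiableAt]
  filter_upwards [(isOpen_lt Complex.continuous_re continuous_const).mem_nhds hz] with w hw
  exact H.differentiableAt_leftExtension hw

theorem Aplus_mem_Gplus (H : S.IsStripBounded h M) (x : X) : S.Aplus h x ∈ S.Gplus := by
  classical
  obtain ⟨K, hK⟩ := H.norm_leftExtension_le
  let φ : ℂ → X := fun z =>
    if z ∈ S.resolventSet then S.resolventOp z (S.Aplus h x) else S.leftExtension h z x
  have h1 : ∀ z ∈ S.resolventSet, φ z = S.resolventOp z (S.Aplus h x) := fun z hz => if_pos hz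
  have h2 : ∀ z : ℂ, z.re < h → φ z = S.leftExtension h z x := by
    intro z hz
    by_cases hzS : z ∈ S.resolventSet
    · rw [h1 z hzS, H.leftExtension_eq hz hzS]
      rfl
    · exact if_neg hzS
  refine ⟨φ, ?_, h1, K * ‖x‖, fun z hz => ?_⟩
  · intro z hz
    by_cases hzS : z ∈ S.resolventSet
    · have h3 : AnalyticAt ℂ (fun z => S.resolventOp z (S.Aplus h x)) z :=
        (ContinuousLinearMap.apply ℂ X (S.Aplus h x)).analyticAt _ |>.fun_comp
          (S.analyticOnNhd_resolventOp z hzS)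
      refine h3.congr ?_
      filter_upwards [S.isOpen_resolventSet.mem_nhds hzS] with w hw using (h1 w hw).symm
    · have hz' : z.re < h := lt_of_le_of_lt (hz.resolve_right hzS) H.pos
      have h3 : AnalyticAt ℂ (fun z => S.leftExtension h z x) z :=
        (ContinuousLinearMap.apply ℂ X x).analyticAt _ |>.fun_comp
          (H.analyticAt_leftExtension hz')
      refine h3.congr ?_
      filter_upwards [(isOpen_lt Complex.continuous_re continuous_const).mem_nhds hz'] with w hw
        using (h2 w hw).symm
  · have hz' : z.re ≤ 0 := hz
    rw [h2 z (lt_of_le_of_lt hz' H.pos)]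
    exact ((S.leftExtension h z).le_opNorm x).trans (by gcongr; exact hK z hz')

end IsStripBounded

theorem extensionSpace_neg_le (S : X →ₗ.[ℂ] X) (K : Set ℂ) :
    S.extensionSpace K ≤ (-S).extensionSpace {z | -z ∈ K} := by
  rintro x ⟨φ, h1, h2, C, h3⟩
  refine ⟨fun z => -φ (-z), ?_, fun z hz => ?_, C, fun z hz => ?_⟩
  · intro z hz
    refine AnalyticAt.fun_neg (AnalyticAt.fun_comp (h1 (-z) ?_) analyticAt_id.fun_neg)
    exact hz.imp id mem_resolventSet_neg_iff.mp
  · simp only [resolventOp_neg, h2 _ (mem_resolventSet_neg_iff.mp hz), _root_.neg_apply]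
  · rw [norm_neg]
    exact h3 _ hz

theorem Gminus_eq (S : X →ₗ.[ℂ] X) : S.Gminus = (-S).Gplus := by
  have e1 : {z : ℂ | -z ∈ {z : ℂ | 0 ≤ z.re}} = {z : ℂ | z.re ≤ 0} := by ext; simp
  have e2 : {z : ℂ | -z ∈ {z : ℂ | z.re ≤ 0}} = {z : ℂ | 0 ≤ z.re} := by ext; simp
  apply le_antisymm
  · have := S.extensionSpace_neg_le {z : ℂ | 0 ≤ z.re}
    rwa [e1] at this
  · have := (-S).extensionSpace_neg_le {z : ℂ | z.re ≤ 0}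
    rwa [e2, neg_neg] at this

/-- An extension composed with a bounded operator commuting with the resolvent. -/
theorem map_mem_extensionSpace {T : X →L[ℂ] X}
    (hT : ∀ z ∈ S.resolventSet, Commute (S.resolventOp z) T) {K : Set ℂ} {x : X}
    (hx : x ∈ S.extensionSpace K) : T x ∈ S.extensionSpace K := by
  obtain ⟨φ, h1, h2, C, h3⟩ := hx
  refine ⟨fun z => T (φ z), fun z hz => (T.analyticAt _).fun_comp (h1 z hz), fun z hz => ?_,
    ‖T‖ * C, fun z hz => ?_⟩
  · simp only [h2 z hz]
    exact (DFunLike.congr_fun (hT z hz) x).symm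
  · exact (T.le_opNorm _).trans (mul_le_mul_of_nonneg_left (h3 z hz) (norm_nonneg _))

namespace IsStripBounded

/-- The two extensions agree on the strip and glue to a bounded entire function, constant by
Liouville's theorem. A resolvent orbit that is constant on the imaginary axis forces `x = 0`. -/
theorem disjoint_G (H : S.IsStripBounded h M) : Disjoint S.Gplus S.Gminus := by
  classical
  rw [Submodule.disjoint_def]
  rintro x ⟨φ, h1, h2, C, h3⟩ ⟨ψ, k1, k2, D, k3⟩
  let f : ℂ → X := fun z => if z.re ≤ 0 then φ z else ψ z
  have hstrip : ∀ z : ℂ, |z.re| ≤ h → φ z = ψ z := fun z hz => by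
    rw [h2 z (H.mem hz), k2 z (H.mem hz)]
  have hφ : ∀ z : ℂ, z.re < h → f z = φ z := by
    intro z hz
    by_cases hz0 : z.re ≤ 0
    · exact if_pos hz0
    · refine (if_neg hz0).trans (hstrip z ?_).symm
      rw [abs_of_pos (not_le.mp hz0)]
      exact hz.le
  have hψ : ∀ z : ℂ, 0 < z.re → f z = ψ z := fun z hz => if_neg (not_le.mpr hz)
  have hd : Differentiable ℂ f := by
    intro z
    by_cases hz0 : z.re ≤ 0
    · refine (h1 z (Or.inl hz0)).differentiableAt.congr_of_eventuallyEq ?_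
      filter_upwards [(isOpen_lt Complex.continuous_re continuous_const).mem_nhds
        (lt_of_le_of_lt hz0 H.pos)] with w hw using hφ w hw
    · have hz1 : 0 < z.re := not_le.mp hz0
      refine (k1 z (Or.inl hz1.le)).differentiableAt.congr_of_eventuallyEq ?_
      filter_upwards [(isOpen_lt continuous_const Complex.continuous_re).mem_nhds hz1]
        with w hw using hψ w hw
  have hb : Bornology.IsBounded (Set.range f) := by
    rw [isBounded_iff_forall_norm_le]
    refine ⟨max C D, ?_⟩
    rintro _ ⟨z, rfl⟩
    by_cases hz0 : z.re ≤ 0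
    · rw [hφ z (lt_of_le_of_lt hz0 H.pos)]
      exact (h3 z hz0).trans (le_max_left _ _)
    · rw [hψ z (not_le.mp hz0)]
      exact (k3 z (not_le.mp hz0).le).trans (le_max_right _ _)
  have hval : ∀ z : ℂ, z.re = 0 → S.resolventOp z x = S.resolventOp 0 x := by
    intro z hz
    have := hd.apply_eq_apply_of_bounded hb z 0
    rwa [hφ z (by rw [hz]; exact H.pos), hφ 0 H.pos, h2 z (H.mem (by simp [hz, H.pos.le])),
      h2 0 H.zero_mem] at this
  -- Any nonzero point of the strip on the imaginary axis would do; at `i` the resolvent identity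
  -- reduces to `R(0)² x = 0`.
  have e1 := DFunLike.congr_fun (H.resolventOp_eq (z := I) (H.mem (by simp [H.pos.le]))) x
  simp only [_root_.add_apply, _root_.smul_apply, mul_apply_eq_comp, hval I (by simp),
    left_eq_add, smul_eq_zero, Complex.I_ne_zero, false_or] at e1
  have hinj := H.isResolventAt_zero.injective
  exact (map_eq_zero_iff _ hinj).mp ((map_eq_zero_iff _ hinj).mp e1)

variable [CompleteSpace X]

theorem Aminus_mem_Gminus (H : S.IsStripBounded h M) (x : X) : S.Aminus h x ∈ S.Gminus := by
  rw [Aminus_eq, Gminus_eq]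
  exact H.neg.Aplus_mem_Gplus x

theorem dense_G (H : S.IsStripBounded h M) (hd : Dense (S.domain : Set X)) :
    Dense ((S.Gplus ⊔ S.Gminus : Submodule ℂ X) : Set X) := by
  refine (H.isResolventAt_zero.dense_square_domain hd).mono fun x hx => ?_
  have e := H.isResolventAt_zero.square_iff.mp ⟨hx, rfl⟩
  set y := S.square ⟨x, hx⟩
  have e2 := DFunLike.congr_fun H.Aplus_add_Aminus y
  have : x = S.Aplus h y + S.Aminus h y := e.trans e2.symm
  rw [this]
  exact Submodule.add_mem_sup (H.Aplus_mem_Gplus y) (H.Aminus_mem_Gminus y)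

/-- `A₊ x` always lies in `G₊`; it also lies in `G₋` when `x` does, since `A₊` commutes with the
resolvent. -/
theorem Aplus_eq_zero_of_mem_Gminus (H : S.IsStripBounded h M) {x : X} (hx : x ∈ S.Gminus) :
    S.Aplus h x = 0 :=
  Submodule.disjoint_def.mp H.disjoint_G _ (H.Aplus_mem_Gplus x)
    (map_mem_extensionSpace (fun _ hz => H.commute_resolventOp_Aplus hz) hx)

theorem Aplus_mul_Aminus (H : S.IsStripBounded h M) : S.Aplus h * S.Aminus h = 0 := by
  ext x
  exact H.Aplus_eq_zero_of_mem_Gminus (H.Aminus_mem_Gminus x)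

theorem Aminus_eq_zero_of_mem_Gplus (H : S.IsStripBounded h M) {x : X} (hx : x ∈ S.Gplus) :
    S.Aminus h x = 0 := by
  rw [Aminus_eq]
  apply H.neg.Aplus_eq_zero_of_mem_Gminus
  rwa [Gminus_eq, neg_neg]

theorem Aminus_mul_Aplus (H : S.IsStripBounded h M) : S.Aminus h * S.Aplus h = 0 := by
  ext x
  exact H.Aminus_eq_zero_of_mem_Gplus (H.Aplus_mem_Gplus x)

end IsStripBounded

end Extension

end LinearPMap

/-- Phragmén–Lindelöf for functions of quadratic growth on the right half-plane. -/
theorem norm_le_of_quadratic_growth {E : Type*} [NormedAddCommGroup E] [NormedSpace ℂ E]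
    {f : ℂ → E} {C K : ℝ} (hd : DiffContOnCl ℂ f {z | 0 < z.re})
    (hK : ∀ z : ℂ, 0 ≤ z.re → ‖f z‖ ≤ K * (1 + ‖z‖) ^ 2)
    (him : ∀ t : ℝ, ‖f (t * Complex.I)‖ ≤ C) {z : ℂ} (hz : 0 ≤ z.re) : ‖f z‖ ≤ C := by
  have hK0 : 0 ≤ K := by
    have := (norm_nonneg _).trans (hK 0 le_rfl)
    simpa using this
  have hcl : closure {z : ℂ | 0 < z.re} = {z : ℂ | 0 ≤ z.re} := Complex.closure_setOfPred_lt_re 0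
  -- Dividing by `(1 + ε z)²` makes the function bounded, and does not increase it on the imaginary
  -- axis since `|1 + ε z| ≥ 1` there. Then `ε → 0`.
  have key : ∀ ε : ℝ, 0 < ε → ‖f z‖ ≤ C * ‖1 + (ε : ℂ) * z‖ ^ 2 := by
    intro ε hε
    have hre : ∀ w : ℂ, 0 ≤ w.re → 1 ≤ ‖1 + (ε : ℂ) * w‖ := by
      intro w hw
      refine le_trans ?_ (Complex.re_le_norm _)
      simp
      positivity
    have hmul : ∀ w : ℂ, 0 ≤ w.re → ε * ‖w‖ ≤ ‖1 + (ε : ℂ) * w‖ := by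
      intro w hw
      have h1 : ε * ‖w‖ = ‖(ε : ℂ) * w‖ := by
        rw [norm_mul, Complex.norm_real, Real.norm_of_nonneg hε.le]
      rw [h1]
      apply le_of_sq_le_sq _ (norm_nonneg _)
      rw [← Complex.normSq_eq_norm_sq, ← Complex.normSq_eq_norm_sq, Complex.normSq_apply,
        Complex.normSq_apply]
      have h2 : 0 ≤ ((ε : ℂ) * w).re := by simp; positivity
      simp only [Complex.add_re, Complex.one_re, Complex.add_im, Complex.one_im, zero_add]
      nlinarith
    have hne : ∀ w : ℂ, 0 ≤ w.re → 1 + (ε : ℂ) * w ≠ 0 := fun w hw e => by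
      have := hre w hw
      rw [e, norm_zero] at this
      linarith
    let g : ℂ → E := fun w => ((1 + (ε : ℂ) * w) ^ 2)⁻¹ • f w
    have hgn : ∀ w, ‖g w‖ = ‖f w‖ / ‖1 + (ε : ℂ) * w‖ ^ 2 := fun w => by
      simp only [g]
      rw [norm_smul, norm_inv, norm_pow, div_eq_inv_mul]
    have hgd : DiffContOnCl ℂ g {z | 0 < z.re} := by
      refine DiffContOnCl.smul (DifferentiableOn.diffContOnCl fun w hw => ?_) hd
      rw [hcl] at hw
      have := pow_ne_zero 2 (hne w hw)
      apply DifferentiableAt.differentiableWithinAt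
      fun_prop (disch := assumption)
    have hgb : ∀ w : ℂ, 0 ≤ w.re → ‖g w‖ ≤ K * (1 + ε⁻¹) ^ 2 := by
      intro w hw
      have h1 := hre w hw
      rw [hgn, div_le_iff₀ (by positivity), mul_assoc, ← mul_pow]
      refine (hK w hw).trans ?_
      gcongr
      have : ‖w‖ ≤ ε⁻¹ * ‖1 + (ε : ℂ) * w‖ := by
        rw [inv_mul_eq_div, le_div_iff₀ hε, mul_comm]
        exact hmul w hw
      linarith
    have hgi : ∀ t : ℝ, ‖g (t * Complex.I)‖ ≤ C := by
      intro t
      have h1 := hre (t * Complex.I) (by simp)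
      rw [hgn]
      exact (div_le_self (norm_nonneg _) (one_le_pow₀ h1)).trans (him t)
    -- Growth exponent and constant are both `0`: the quotient `g` is bounded.
    have := PhragmenLindelof.right_half_plane_of_bounded_on_real hgd ⟨0, two_pos, 0, ?_⟩ ?_ hgi hz
    · rw [hgn, div_le_iff₀ (pow_pos (lt_of_lt_of_le one_pos (hre z hz)) 2)] at this
      exact this
    · refine Asymptotics.IsBigO.of_bound (K * (1 + ε⁻¹) ^ 2) ?_
      filter_upwards [mem_inf_of_right (mem_principal_self _)] with w hw
      simpa using hgb w (le_of_lt hw)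
    · refine ⟨K * (1 + ε⁻¹) ^ 2, ?_⟩
      rw [eventually_map]
      filter_upwards [eventually_ge_atTop 0] with t ht
      exact hgb t (by simpa using ht)
  have hlim : Tendsto (fun ε : ℝ => C * ‖1 + (ε : ℂ) * z‖ ^ 2) (𝓝[>] 0) (𝓝 C) := by
    have hc : Continuous fun ε : ℝ => C * ‖1 + (ε : ℂ) * z‖ ^ 2 := by fun_prop
    have := hc.tendsto 0
    simp only [Complex.ofReal_zero, zero_mul, add_zero, norm_one, one_pow, mul_one] at this
    exact this.mono_left nhdsWithin_le_nhds
  exact ge_of_tendsto hlim (eventually_nhdsWithin_of_forall fun ε hε => key ε hε)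

namespace LinearPMap

/-! ### The resolvent of the restriction of `S` to a spectral subspace. -/

section Restriction

open Complex (I)

variable {X : Type*} [NormedAddCommGroup X] [NormedSpace ℂ X] {S : X →ₗ.[ℂ] X} {h M : ℝ}

theorem IsInvariant.neg {V : Submodule ℂ X} (hV : S.IsInvariant V) : (-S).IsInvariant V :=
  fun x hx => V.neg_mem (hV x hx)

theorem restrictTo_neg {V : Submodule ℂ X} (hV : S.IsInvariant V) :
    (-S).restrictTo V hV.neg = -S.restrictTo V hV := rfl

/-- The operator that restricts to `(S|X₊ - z)⁻¹` for `Re z ≤ 0`. -/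
noncomputable def leftResolvent (S : X →ₗ.[ℂ] X) (h : ℝ) (z : ℂ) : X →L[ℂ] X :=
  S.resolventOp 0 + z • (S.resolventOp 0 * S.resolventOp 0) + z ^ 2 • S.leftExtension h z

namespace IsStripBounded

theorem isInvariant (H : S.IsStripBounded h M) {V : Submodule ℂ X}
    (hV : ∀ x, S.resolventOp 0 x ∈ V → x ∈ V) : S.IsInvariant V := by
  intro x hx
  apply hV
  have := H.isResolventAt_zero.2 x
  rw [zero_smul, sub_zero] at this
  rwa [this]

variable [CompleteSpace X]

theorem commute_leftResolvent (H : S.IsStripBounded h M) {T : X →L[ℂ] X}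
    (hT : ∀ z : ℂ, |z.re| ≤ h → Commute T (S.resolventOp z)) {z : ℂ} (hz : z.re < h) :
    Commute T (S.leftResolvent h z) := by
  have h0 := hT 0 (by simpa using H.pos.le)
  exact (h0.add_right ((h0.mul_right h0).smul_right _)).add_right
    ((H.commute_leftExtension hT hz).smul_right _)

/-- The form of `leftResolvent` is the expansion `R(z) = R(0) + z R(0)² + z² R(z) R(0)²`, with `R(z)
R(0)² x = R(z) A₊ x` replaced by its continuation `leftExtension`. The identity says `(S - z) y = x`
for `y` the value at `x`, after applying `R(0)`. -/
theorem one_sub_mul_leftResolvent_apply (H : S.IsStripBounded h M) {z : ℂ} (hz : z.re < h)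
    {x : X} (hx : S.Aplus h x = S.resolventOp 0 (S.resolventOp 0 x)) :
    S.leftResolvent h z x - z • S.resolventOp 0 (S.leftResolvent h z x) =
      S.resolventOp 0 x := by
  have e := DFunLike.congr_fun (H.one_sub_mul_leftExtension hz) x
  simp only [mul_apply_eq_comp, _root_.sub_apply, one_apply_eq_self, _root_.smul_apply, hx] at e
  simp only [leftResolvent, _root_.add_apply, _root_.smul_apply, mul_apply_eq_comp,
    _root_.map_add, _root_.map_smul]
  linear_combination (norm := module) (z ^ 2) • e

theorem leftResolvent_apply_eq (H : S.IsStripBounded h M) {z : ℂ} (hz : z.re < h)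
    (hzS : z ∈ S.resolventSet)
    {x : X} (hx : S.Aplus h x = S.resolventOp 0 (S.resolventOp 0 x)) :
    S.leftResolvent h z x = S.resolventOp z x := by
  have e := H.one_sub_mul_leftResolvent_apply hz hx
  have e' : S.leftResolvent h z x = S.resolventOp 0 (x + z • S.leftResolvent h z x) := by
    rw [_root_.map_add, _root_.map_smul, ← e]
    abel
  obtain ⟨h1, h2⟩ := H.isResolventAt_zero.1 (x + z • S.leftResolvent h z x)
  rw [zero_smul, sub_zero] at h2
  refine ((isResolventAt_resolventOp hzS).apply_eq (x := S.leftResolvent h z x)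
    (by rw [e']; exact h1) ?_).symm
  simp only [← e'] at h2
  rw [h2]
  abel

/-- `leftExtension` is bounded on the left half-plane, so the growth is at most quadratic, while on
the imaginary axis the value is the true resolvent, of norm at most `M`. Phragmén–Lindelöf applies
after `z ↦ -z`. -/
theorem norm_leftResolvent_apply_le (H : S.IsStripBounded h M) {z : ℂ} (hz : z.re ≤ 0)
    {x : X} (hx : S.Aplus h x = S.resolventOp 0 (S.resolventOp 0 x)) :
    ‖S.leftResolvent h z x‖ ≤ M * ‖x‖ := by
  obtain ⟨K, hK⟩ := H.norm_leftExtension_le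
  have hK0 : 0 ≤ K := (norm_nonneg _).trans (hK 0 le_rfl)
  have hd : ∀ w : ℂ, w.re < h → DifferentiableAt ℂ (S.leftResolvent h) w := by
    intro w hw
    have h1 := H.differentiableAt_leftExtension hw
    unfold leftResolvent
    fun_prop
  have hlt : ∀ w : ℂ, 0 ≤ w.re → (-w).re < h := fun w hw => by
    rw [Complex.neg_re]
    linarith [H.pos]
  have := norm_le_of_quadratic_growth (f := fun w => S.leftResolvent h (-w) x) (C := M * ‖x‖)
    (K := (‖S.resolventOp 0‖ + ‖S.resolventOp 0 * S.resolventOp 0‖ + K) * ‖x‖)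
    ?_ ?_ ?_ (z := -z) (by simpa using hz)
  · simpa using this
  · refine DifferentiableOn.diffContOnCl fun w hw => ?_
    rw [Complex.closure_setOfPred_lt_re] at hw
    have h1 : DifferentiableAt ℂ (fun w => S.leftResolvent h (-w)) w :=
      DifferentiableAt.comp w (hd (-w) (hlt w hw)) differentiableAt_id.fun_neg
    exact (h1.clm_apply (differentiableAt_const x)).differentiableWithinAt
  · intro w hw
    refine (ContinuousLinearMap.le_opNorm _ _).trans ?_
    rw [mul_right_comm]
    gcongr
    have h1 : ‖S.leftExtension h (-w)‖ ≤ K := hK _ (by simpa using hw)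
    have h2 : (1 : ℝ) ≤ (1 + ‖w‖) ^ 2 := one_le_pow₀ (by linarith [norm_nonneg w])
    have h3 : ‖w‖ ≤ (1 + ‖w‖) ^ 2 := by nlinarith [norm_nonneg w]
    have h4 : ‖w‖ ^ 2 ≤ (1 + ‖w‖) ^ 2 := by gcongr; linarith
    unfold leftResolvent
    calc _ ≤ ‖S.resolventOp 0‖ + ‖(-w) • (S.resolventOp 0 * S.resolventOp 0)‖ +
          ‖(-w) ^ 2 • S.leftExtension h (-w)‖ := norm_add₃_le
      _ = ‖S.resolventOp 0‖ * 1 + ‖S.resolventOp 0 * S.resolventOp 0‖ * ‖w‖ +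
          ‖S.leftExtension h (-w)‖ * ‖w‖ ^ 2 := by
        rw [norm_smul, norm_smul, norm_pow, norm_neg]
        ring
      _ ≤ ‖S.resolventOp 0‖ * (1 + ‖w‖) ^ 2 +
          ‖S.resolventOp 0 * S.resolventOp 0‖ * (1 + ‖w‖) ^ 2 + K * (1 + ‖w‖) ^ 2 := by
        gcongr
      _ = _ := by ring
  · intro t
    have h1 : |(-((t : ℂ) * I)).re| ≤ h := by simpa using H.pos.le
    rw [H.leftResolvent_apply_eq (hlt _ (by simp)) (H.mem h1) hx]
    exact ((S.resolventOp _).le_opNorm x).trans (by gcongr; exact H.bound _ h1)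

/-- On `X₊ = {x | A₊ x = S⁻² x}` the resolvent of `S` exists on the closed left half-plane and is
bounded by the bound of the resolvent of `S` on the imaginary axis. -/
theorem exists_isResolventAt_restrictTo (H : S.IsStripBounded h M) {V : Submodule ℂ X}
    (hV : ∀ x, x ∈ V ↔ S.Aplus h x = S.resolventOp 0 (S.resolventOp 0 x))
    (hinv : S.IsInvariant V) {z : ℂ} (hz : z.re ≤ 0) :
    ∃ T : V →L[ℂ] V, (S.restrictTo V hinv).IsResolventAt z T ∧ ‖T‖ ≤ M := by
  have hzh : z.re < h := lt_of_le_of_lt hz H.pos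
  have hcR : Commute (S.resolventOp 0) (S.leftResolvent h z) :=
    H.commute_leftResolvent (fun w hw => commute_resolventOp H.zero_mem (H.mem hw)) hzh
  have hcA : Commute (S.Aplus h) (S.leftResolvent h z) :=
    H.commute_leftResolvent (fun w hw => (H.commute_resolventOp_Aplus (H.mem hw)).symm) hzh
  have hcR' : ∀ x, S.resolventOp 0 (S.leftResolvent h z x) =
    S.leftResolvent h z (S.resolventOp 0 x) := DFunLike.congr_fun hcR
  have hcA' : ∀ x, S.Aplus h (S.leftResolvent h z x) =
    S.leftResolvent h z (S.Aplus h x) := DFunLike.congr_fun hcA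
  have hmap : ∀ x ∈ V, S.leftResolvent h z x ∈ V := by
    intro x hx
    rw [hV] at hx ⊢
    rw [hcA', hcR', hcR', hx]
  let T : V →L[ℂ] V :=
    LinearMap.mkContinuous ((S.leftResolvent h z : X →ₗ[ℂ] X).restrict hmap) M fun x =>
      H.norm_leftResolvent_apply_le hz ((hV _).mp x.2)
  have hT : ∀ x : V, ((T x : V) : X) = S.leftResolvent h z x := fun _ => rfl
  refine ⟨T, ⟨fun y => ?_, fun x => ?_⟩, LinearMap.mkContinuous_norm_le _ H.bound_nonneg _⟩
  · have e := H.one_sub_mul_leftResolvent_apply hzh ((hV _).mp y.2)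
    -- In this form the vector is visibly in the range of `R(0)`, that is in `D(S)`, and applying
    -- `S` gives `(S - z)` of it equal to `y`.
    have e' : S.leftResolvent h z y = S.resolventOp 0 (y + z • S.leftResolvent h z y) := by
      rw [_root_.map_add, _root_.map_smul, ← e]
      abel
    obtain ⟨h1, h2⟩ := H.isResolventAt_zero.1 (y + z • S.leftResolvent h z y)
    rw [zero_smul, sub_zero] at h2
    simp only [← e'] at h1 h2
    refine ⟨h1, Subtype.ext ?_⟩
    change S ⟨S.leftResolvent h z y, h1⟩ - z • S.leftResolvent h z y = y
    rw [h2]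
    abel
  · apply Subtype.ext
    have hx : ((x : V) : X) ∈ S.domain := x.2
    have hy : S ⟨x, hx⟩ ∈ V := hinv _ x.1.2
    have e := H.one_sub_mul_leftResolvent_apply hzh ((hV _).mp hy)
    have hx0 : S.resolventOp 0 (S ⟨x, hx⟩) = x :=
      H.isResolventAt_zero.apply_eq hx (by rw [zero_smul, sub_zero])
    rw [hcR', hx0] at e
    change S.leftResolvent h z (S ⟨x, hx⟩ - z • (x : X)) = x
    rw [_root_.map_sub, _root_.map_smul, e]

end IsStripBounded

end Restriction

end LinearPMap

namespace LinearPMap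

/-! ### The operators `S² A`, and bounded projections versus dichotomy. -/

section Projection

open Complex (I)

variable {X : Type*} [NormedAddCommGroup X] [NormedSpace ℂ X] {S : X →ₗ.[ℂ] X} {h M : ℝ}

/-- If `0 ∈ ϱ(S)`, the graph of `S² A` is `{(x, y) | A x = S⁻² y}`. -/
theorem IsResolventAt.square_pcomp_iff {R : X →L[ℂ] X} (hR : S.IsResolventAt 0 R) (A : X →L[ℂ] X)
    {x y : X} : (∃ hx : x ∈ (S.square.pcomp (ofCLM A)).domain,
      S.square.pcomp (ofCLM A) ⟨x, hx⟩ = y) ↔ A x = R (R y) := by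
  rw [← hR.square_iff]
  constructor
  · rintro ⟨⟨_, hx⟩, e⟩
    exact ⟨hx, e⟩
  · rintro ⟨hx, e⟩
    exact ⟨⟨trivial, hx⟩, e⟩

theorem IsResolventAt.apply_square_pcomp {R : X →L[ℂ] X} (hR : S.IsResolventAt 0 R)
    (A : X →L[ℂ] X) (x : (S.square.pcomp (ofCLM A)).domain) :
    A x = R (R (S.square.pcomp (ofCLM A) x)) :=
  (hR.square_pcomp_iff A).mp ⟨x.2, rfl⟩

theorem IsResolventAt.isClosed_square_pcomp {R : X →L[ℂ] X} (hR : S.IsResolventAt 0 R)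
    (A : X →L[ℂ] X) : (S.square.pcomp (ofCLM A)).IsClosed := by
  have e : ((S.square.pcomp (ofCLM A)).graph : Set (X × X)) = {p | A p.1 = R (R p.2)} := by
    ext ⟨x, y⟩
    simp only [SetLike.mem_coe, mem_graph_iff, Set.mem_ofPred_eq]
    rw [← hR.square_pcomp_iff A]
    constructor
    · rintro ⟨⟨_, hx⟩, rfl, e⟩
      exact ⟨hx, e⟩
    · rintro ⟨hx, e⟩
      exact ⟨⟨x, hx⟩, rfl, e⟩
  unfold LinearPMap.IsClosed
  rw [e]
  exact isClosed_eq (by fun_prop) (by fun_prop)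

/-- If `x = R² u` then `A x = R² (A u)`, so `A u` is the value of `S² A` at `x`. -/
theorem IsResolventAt.square_domain_le {R A : X →L[ℂ] X} (hR : S.IsResolventAt 0 R)
    (hRA : Commute R A) : S.square.domain ≤ (S.square.pcomp (ofCLM A)).domain := by
  intro x hx
  have e := hR.square_iff.mp ⟨hx, rfl⟩
  refine ((hR.square_pcomp_iff A (y := A (S.square ⟨x, hx⟩))).mpr ?_).1
  have hc : ∀ y, R (A y) = A (R y) := DFunLike.congr_fun hRA
  rw [hc, hc, ← e]

/-- For `y = S² A x`, `R² A' y = A' R² y = A' A x = 0`. Hence `A' y = 0` and `A y = R² y`: the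
operator fixes `y`. -/
theorem IsResolventAt.isProjection_square_pcomp {R A A' : X →L[ℂ] X} (hR : S.IsResolventAt 0 R)
    (hRA : Commute R A') (hadd : A + A' = R * R) (hmul : A' * A = 0) :
    (S.square.pcomp (ofCLM A)).IsProjection := by
  intro x
  set y := S.square.pcomp (ofCLM A) x
  have e1 : A x = R (R y) := hR.apply_square_pcomp A x
  have hc : ∀ y, R (A' y) = A' (R y) := DFunLike.congr_fun hRA
  have e2 : A' y = 0 := by
    apply hR.injective
    apply hR.injective
    rw [hc, hc, ← e1, _root_.map_zero, _root_.map_zero]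
    exact DFunLike.congr_fun hmul (x : X)
  apply (hR.square_pcomp_iff A).mpr
  have := DFunLike.congr_fun hadd y
  simpa [e2] using this

theorem IsResolventAt.square_pcomp_eq_ofCLM {R A B : X →L[ℂ] X} (hR : S.IsResolventAt 0 R)
    (hB : A = R * R * B) : S.square.pcomp (ofCLM A) = ofCLM B := by
  have h1 : ∀ x, ∃ hx : x ∈ (S.square.pcomp (ofCLM A)).domain,
      S.square.pcomp (ofCLM A) ⟨x, hx⟩ = B x := fun x =>
    (hR.square_pcomp_iff A).mpr (by rw [hB]; rfl)
  apply LinearPMap.ext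
  · ext x
    exact ⟨fun _ => trivial, fun _ => (h1 x).1⟩
  · intro x hx _
    exact (h1 x).2

/-- If `S² A` is bounded on a dense subspace then `A = S⁻² B` for a bounded operator `B`. -/
theorem IsResolventAt.exists_eq_of_boundedOnDenseSubspace [CompleteSpace X] {R A : X →L[ℂ] X}
    (hR : S.IsResolventAt 0 R) (hd : Dense ((S.square.pcomp (ofCLM A)).domain : Set X))
    (hb : BoundedOnDenseSubspace (S.square.pcomp (ofCLM A)).domain
      fun x => S.square.pcomp (ofCLM A) x) : ∃ B : X →L[ℂ] X, A = R * R * B := by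
  obtain ⟨W, hW, hWd, C, hC⟩ := hb
  have hWdense : Dense (W : Set X) := fun x =>
    closure_minimal hWd isClosed_closure (hd x)
  let f : W →L[ℂ] X := LinearMap.mkContinuous
    ((S.square.pcomp (ofCLM A)).toFun ∘ₗ Submodule.inclusion hW) C
    fun x => hC (Submodule.inclusion hW x) x.2
  have hdr : DenseRange W.subtypeL := by
    simpa [DenseRange] using hWdense
  have hind : IsUniformInducing W.subtypeL := isUniformInducing_val _
  refine ⟨f.extend W.subtypeL, ?_⟩
  refine ContinuousLinearMap.coeFn_injective (Continuous.ext_on hWdense A.continuous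
    (ContinuousLinearMap.continuous _) fun x hx => ?_)
  have h1 : f.extend W.subtypeL x = f ⟨x, hx⟩ :=
    f.extend_eq hdr hind ⟨x, hx⟩
  simp only [mul_apply_eq_comp, h1]
  exact hR.apply_square_pcomp A ⟨x, hW hx⟩

/-- An invariant subspace on which the resolvent of `S` is bounded on the closed left half-plane
lies in `G₊`. -/
theorem le_Gplus [CompleteSpace X] {V : Submodule ℂ X} (hVc : _root_.IsClosed (V : Set X))
    (hinv : S.IsInvariant V)
    (hres : ∀ z : ℂ, z.re ≤ 0 → z ∈ (S.restrictTo V hinv).resolventSet)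
    (hbdd : ∃ M : ℝ, ∀ z : ℂ, z.re ≤ 0 → ‖(S.restrictTo V hinv).resolventOp z‖ ≤ M) :
    V ≤ S.Gplus := by
  classical
  intro x hx
  obtain ⟨M, hM⟩ := hbdd
  have : CompleteSpace V := hVc.completeSpace_coe
  set T := S.restrictTo V hinv
  let φ : ℂ → X := fun z =>
    if z ∈ S.resolventSet then S.resolventOp z x else (T.resolventOp z ⟨x, hx⟩ : V)
  have h1 : ∀ z ∈ S.resolventSet, φ z = S.resolventOp z x := fun z hz => if_pos hz
  -- Where both resolvents exist they agree on `x`, because the restricted one already solves `(S -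
  -- z) u = x`; so the two pieces of `φ` glue.
  have h2 : ∀ z ∈ T.resolventSet, φ z = (T.resolventOp z ⟨x, hx⟩ : V) := by
    intro z hz
    by_cases hzS : z ∈ S.resolventSet
    · rw [h1 z hzS]
      obtain ⟨hd, e⟩ := (isResolventAt_resolventOp hz).1 ⟨x, hx⟩
      exact (isResolventAt_resolventOp hzS).apply_eq hd (congrArg Subtype.val e)
    · exact if_neg hzS
  refine ⟨φ, ?_, h1, M * ‖x‖, fun z hz => ?_⟩
  · intro z hz
    by_cases hzS : z ∈ S.resolventSet
    · have h3 : AnalyticAt ℂ (fun z => S.resolventOp z x) z :=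
        (ContinuousLinearMap.apply ℂ X x).analyticAt _ |>.fun_comp
          (S.analyticOnNhd_resolventOp z hzS)
      refine h3.congr ?_
      filter_upwards [S.isOpen_resolventSet.mem_nhds hzS] with w hw using (h1 w hw).symm
    · have hz' : z ∈ T.resolventSet := hres z (hz.resolve_right hzS)
      have h3 : AnalyticAt ℂ (fun z => ((T.resolventOp z ⟨x, hx⟩ : V) : X)) z :=
        (V.subtypeL ∘L ContinuousLinearMap.apply ℂ V (⟨x, hx⟩ : V)).analyticAt _ |>.fun_comp
          (T.analyticOnNhd_resolventOp z hz')
      refine h3.congr ?_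
      filter_upwards [T.isOpen_resolventSet.mem_nhds hz'] with w hw using (h2 w hw).symm
  · rw [h2 z (hres z hz)]
    exact ((T.resolventOp z).le_opNorm ⟨x, hx⟩).trans
      (mul_le_mul_of_nonneg_right (hM z hz) (norm_nonneg _))

theorem IsStrictlyDichotomousWrt.pos_le_Gplus [CompleteSpace X] {Xp Xm : Submodule ℂ X}
    (hS : S.IsStrictlyDichotomousWrt Xp Xm) : Xp ≤ S.Gplus :=
  le_Gplus hS.isClosed_pos hS.inv_pos
    (fun z hz => by
      by_contra hz'
      exact absurd (hS.spec_pos hz') (not_lt.mpr hz)) hS.bdd_pos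

theorem IsStrictlyDichotomousWrt.neg_le_Gminus [CompleteSpace X] {Xp Xm : Submodule ℂ X}
    (hS : S.IsStrictlyDichotomousWrt Xp Xm) : Xm ≤ S.Gminus := by
  rw [Gminus_eq]
  refine le_Gplus hS.isClosed_neg hS.inv_neg.neg (fun z hz => ?_) ?_
  · rw [restrictTo_neg hS.inv_neg, mem_resolventSet_neg_iff]
    by_contra hz'
    have : (-z).re < 0 := hS.spec_neg hz'
    rw [Complex.neg_re] at this
    linarith
  · obtain ⟨M, hM⟩ := hS.bdd_neg
    refine ⟨M, fun z hz => ?_⟩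
    rw [restrictTo_neg hS.inv_neg, resolventOp_neg, norm_neg]
    exact hM _ (by simpa using hz)

namespace IsStripBounded

variable [CompleteSpace X]

theorem Pint_eq (H : S.IsStripBounded h M) (x : S.square.domain) :
    S.Pint h x = S.Aplus h (S.square x) :=
  (H.Aplus_apply _).symm

theorem commute_Aplus_zero (H : S.IsStripBounded h M) :
    Commute (S.resolventOp 0) (S.Aplus h) :=
  H.commute_resolventOp_Aplus H.zero_mem

theorem commute_Aminus_zero (H : S.IsStripBounded h M) :
    Commute (S.resolventOp 0) (S.Aminus h) := by
  have := H.neg.commute_Aplus_zero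
  rw [resolventOp_neg, neg_zero, ← Aminus_eq] at this
  exact (Commute.neg_left_iff).mp this

theorem Aplus_square_apply (H : S.IsStripBounded h M) (x : S.square.domain) :
    S.Aplus h x = S.resolventOp 0 (S.resolventOp 0 (S.Pint h x)) := by
  have e := H.isResolventAt_zero.square_iff.mp ⟨x.2, rfl⟩
  have hc : ∀ y, S.resolventOp 0 (S.Aplus h y) = S.Aplus h (S.resolventOp 0 y) :=
    DFunLike.congr_fun H.commute_Aplus_zero
  rw [H.Pint_eq, hc, hc, ← e]

theorem square_domain_le_Pplus_domain (H : S.IsStripBounded h M) :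
    S.square.domain ≤ (S.Pplus h).domain :=
  H.isResolventAt_zero.square_domain_le H.commute_Aplus_zero

theorem Pplus_eq_Pint (H : S.IsStripBounded h M) {x : X} (hx : x ∈ S.square.domain)
    (hx' : x ∈ (S.Pplus h).domain) : S.Pplus h ⟨x, hx'⟩ = S.Pint h ⟨x, hx⟩ :=
  ((H.isResolventAt_zero.square_pcomp_iff _).mpr (H.Aplus_square_apply ⟨x, hx⟩)).2

/-- On `X₊ ⊆ G₊` the operator `A₋` vanishes, so `A₊ = S⁻²`; on `X₋ ⊆ G₋` the operator `A₊` vanishes.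
Thus `A₊` is `S⁻²` after the projection onto `X₊`, bounded because both summands are closed. -/
theorem exists_Aplus_eq_of_isStrictlyDichotomous (H : S.IsStripBounded h M)
    (hS : S.IsStrictlyDichotomous) :
    ∃ B : X →L[ℂ] X, S.Aplus h = S.resolventOp 0 * S.resolventOp 0 * B := by
  obtain ⟨Xp, Xm, hS⟩ := hS
  have hc : Submodule.IsTopCompl Xp Xm :=
    Submodule.isTopCompl_iff_isCompl_isClosed.mpr ⟨hS.isCompl, hS.isClosed_pos, hS.isClosed_neg⟩
  refine ⟨Xp.projectionL Xm hc, ?_⟩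
  ext x
  have h1 := Submodule.projectionL_add_projectionL_eq_self hc x
  have h2 := H.Aminus_eq_zero_of_mem_Gplus
    (hS.pos_le_Gplus (Submodule.projectionL_apply_mem hc x))
  have h3 := H.Aplus_eq_zero_of_mem_Gminus
    (hS.neg_le_Gminus (Submodule.projectionL_apply_mem hc.symm x))
  have h4 := DFunLike.congr_fun H.Aplus_add_Aminus (Xp.projectionL Xm hc x)
  rw [_root_.add_apply, h2, add_zero] at h4
  nth_rw 1 [← h1]
  rw [_root_.map_add, h3, add_zero, h4]
  rfl

/-- `B` is needed only for the two kernels to span `X`: `x = B x + (x - B x)`, where `S⁻² B x = A₊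
x` is killed by `A₋` and `S⁻² (x - B x) = A₋ x` by `A₊`. -/
theorem isStrictlyDichotomousWrt_of_Aplus_eq (H : S.IsStripBounded h M) {B : X →L[ℂ] X}
    (hB : S.Aplus h = S.resolventOp 0 * S.resolventOp 0 * B) :
    S.IsStrictlyDichotomousWrt (S.Aminus h : X →ₗ[ℂ] X).ker (S.Aplus h : X →ₗ[ℂ] X).ker := by
  have hinj := H.isResolventAt_zero.injective
  have hcp : ∀ y, S.resolventOp 0 (S.Aplus h y) = S.Aplus h (S.resolventOp 0 y) :=
    DFunLike.congr_fun H.commute_Aplus_zero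
  have hcm : ∀ y, S.resolventOp 0 (S.Aminus h y) = S.Aminus h (S.resolventOp 0 y) :=
    DFunLike.congr_fun H.commute_Aminus_zero
  have hadd : ∀ x, S.Aplus h x + S.Aminus h x = S.resolventOp 0 (S.resolventOp 0 x) :=
    DFunLike.congr_fun H.Aplus_add_Aminus
  have hBx : ∀ x, S.Aplus h x = S.resolventOp 0 (S.resolventOp 0 (B x)) :=
    DFunLike.congr_fun hB
  have hpm : ∀ x, S.Aplus h (S.Aminus h x) = 0 := DFunLike.congr_fun H.Aplus_mul_Aminus
  have hmp : ∀ x, S.Aminus h (S.Aplus h x) = 0 := DFunLike.congr_fun H.Aminus_mul_Aplus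
  set Xp := (S.Aminus h : X →ₗ[ℂ] X).ker
  set Xm := (S.Aplus h : X →ₗ[ℂ] X).ker
  have memp : ∀ x, x ∈ Xp ↔ S.Aminus h x = 0 := fun x => LinearMap.mem_ker
  have memm : ∀ x, x ∈ Xm ↔ S.Aplus h x = 0 := fun x => LinearMap.mem_ker
  have invp : S.IsInvariant Xp := H.isInvariant fun x hx => by
    rw [memp, ← hcm] at hx
    exact (memp x).mpr ((map_eq_zero_iff _ hinj).mp hx)
  have invm : S.IsInvariant Xm := H.isInvariant fun x hx => by
    rw [memm, ← hcp] at hx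
    exact (memm x).mpr ((map_eq_zero_iff _ hinj).mp hx)
  have resp : ∀ z : ℂ, z.re ≤ 0 →
      ∃ T : Xp →L[ℂ] Xp, (S.restrictTo Xp invp).IsResolventAt z T ∧ ‖T‖ ≤ M := fun z hz =>
    H.exists_isResolventAt_restrictTo (fun x => by rw [memp, ← hadd, left_eq_add]) invp hz
  have resm : ∀ z : ℂ, 0 ≤ z.re →
      ∃ T : Xm →L[ℂ] Xm, (S.restrictTo Xm invm).IsResolventAt z T ∧ ‖T‖ ≤ M := by
    intro z hz
    obtain ⟨T, hT, hTM⟩ := H.neg.exists_isResolventAt_restrictTo (V := Xm) (z := -z)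
      (fun x => by
        rw [resolventOp_neg, neg_zero, ← Aminus_eq, memm]
        simp only [_root_.neg_apply, _root_.map_neg, neg_neg]
        rw [← hadd, right_eq_add]) invm.neg (by simpa using hz)
    rw [restrictTo_neg invm, isResolventAt_neg_iff, neg_neg] at hT
    exact ⟨-T, hT, (ContinuousLinearMap.opNorm_neg T).trans_le hTM⟩
  refine
    { isClosed_pos := (S.Aminus h).isClosed_ker
      isClosed_neg := (S.Aplus h).isClosed_ker
      isCompl := ?_
      imaginary_axis := fun z hz => H.mem (by
        rw [show z.re = 0 from hz, abs_zero]
        exact H.pos.le)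
      inv_pos := invp
      inv_neg := invm
      spec_pos := fun z hz => ?_
      spec_neg := fun z hz => ?_
      bdd_pos := ⟨M, fun z hz => ?_⟩
      bdd_neg := ⟨M, fun z hz => ?_⟩ }
  · constructor
    · rw [Submodule.disjoint_def]
      intro x h1 h2
      rw [memp] at h1
      rw [memm] at h2
      have := hadd x
      rw [h1, h2, add_zero] at this
      exact (map_eq_zero_iff _ hinj).mp ((map_eq_zero_iff _ hinj).mp this.symm)
    · rw [codisjoint_iff, Submodule.eq_top_iff']
      intro x
      rw [← add_sub_cancel (B x) x]
      refine Submodule.add_mem_sup ?_ ?_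
      · rw [memp]
        apply hinj
        apply hinj
        rw [hcm, hcm, ← hBx, hmp, _root_.map_zero, _root_.map_zero]
      · rw [memm]
        apply hinj
        apply hinj
        rw [hcp, hcp, _root_.map_sub, _root_.map_sub, ← hBx, ← hadd, add_sub_cancel_left, hpm,
          _root_.map_zero, _root_.map_zero]
  · by_contra hz'
    obtain ⟨T, hT, -⟩ := resp z (not_lt.mp hz')
    exact hz ⟨T, hT⟩
  · by_contra hz'
    obtain ⟨T, hT, -⟩ := resm z (not_lt.mp hz')
    exact hz ⟨T, hT⟩
  · obtain ⟨T, hT, hTM⟩ := resp z hz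
    rwa [hT.resolventOp_eq]
  · obtain ⟨T, hT, hTM⟩ := resm z hz
    rwa [hT.resolventOp_eq]

end IsStripBounded

end Projection

end LinearPMap

theorem corollary4p3 {X : Type*} [NormedAddCommGroup X] [NormedSpace ℂ X] [CompleteSpace X]
    (S : X →ₗ.[ℂ] X) (hdense : Dense (S.domain : Set X))
    (h : ℝ) (hpos : 0 < h)
    (hstrip : {z : ℂ | |z.re| ≤ h} ⊆ S.resolventSet)
    (hbound : ∃ M : ℝ, ∀ z : ℂ, |z.re| ≤ h → ‖S.resolventOp z‖ ≤ M) :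
    -- the integrals defining `A₊`, `A₋` and `P` converge absolutely
    (VerticalIntegrable h (fun z : ℂ => (1 / z ^ 2) • S.resolventOp z) ∧
      VerticalIntegrable (-h) (fun z : ℂ => (1 / z ^ 2) • S.resolventOp z) ∧
      ∀ x : S.square.domain,
        VerticalIntegrable h (fun z : ℂ => (1 / z ^ 2) • S.resolventOp z (S.square x))) ∧
    -- `G₊ ⊕ G₋` is a direct sum and dense
    (Disjoint S.Gplus S.Gminus ∧ Dense ((S.Gplus ⊔ S.Gminus : Submodule ℂ X) : Set X)) ∧
    -- `P₊` and `P₋` are closed, densely defined projections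
    ((S.Pplus h).IsClosed ∧ (S.Pplus h).IsProjection ∧ Dense ((S.Pplus h).domain : Set X)) ∧
    ((S.Pminus h).IsClosed ∧ (S.Pminus h).IsProjection ∧ Dense ((S.Pminus h).domain : Set X)) ∧
    -- the three equivalent assertions
    List.TFAE [
      S.IsStrictlyDichotomous,
      BoundedOnDenseSubspace (S.Pplus h).domain (fun x => S.Pplus h x),
      BoundedOnDenseSubspace S.square.domain (S.Pint h)] ∧
    -- in this case `P₊` is the unique bounded extension of `P` to `X`
    (S.IsStrictlyDichotomous →
      ∃ B : X →L[ℂ] X, S.Pplus h = LinearPMap.ofCLM B ∧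
        (∀ x : S.square.domain, B x = S.Pint h x) ∧
        ∀ B' : X →L[ℂ] X, (∀ x : S.square.domain, B' x = S.Pint h x) → B' = B) := by
  obtain ⟨M, hM⟩ := hbound
  have H : S.IsStripBounded h M := ⟨hpos, hstrip, hM⟩
  have hR := H.isResolventAt_zero
  have hsq : Dense (S.square.domain : Set X) := hR.dense_square_domain hdense
  have hle := H.square_domain_le_Pplus_domain
  have hPd : Dense ((S.Pplus h).domain : Set X) := hsq.mono hle
  have hext : ∀ B : X →L[ℂ] X, S.Aplus h = S.resolventOp 0 * S.resolventOp 0 * B →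
      ∀ x : S.square.domain, B x = S.Pint h x := by
    intro B hB x
    apply hR.injective
    apply hR.injective
    rw [← H.Aplus_square_apply, hB]
    rfl
  refine ⟨⟨H.verticalIntegrable hpos.ne' H.abs_self_le,
      H.verticalIntegrable (neg_ne_zero.mpr hpos.ne') (by rw [abs_neg]; exact H.abs_self_le),
      fun x => H.verticalIntegrable_apply hpos.ne' H.abs_self_le _⟩,
    ⟨H.disjoint_G, H.dense_G hdense⟩,
    ⟨hR.isClosed_square_pcomp _, hR.isProjection_square_pcomp H.commute_Aminus_zero
      H.Aplus_add_Aminus H.Aminus_mul_Aplus, hPd⟩,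
    ⟨hR.isClosed_square_pcomp _, hR.isProjection_square_pcomp H.commute_Aplus_zero
      ((add_comm _ _).trans H.Aplus_add_Aminus) H.Aplus_mul_Aminus,
      hsq.mono (hR.square_domain_le H.commute_Aminus_zero)⟩, ?_, ?_⟩
  · tfae_have 1 → 3 := by
      intro hS
      obtain ⟨B, hB⟩ := H.exists_Aplus_eq_of_isStrictlyDichotomous hS
      refine ⟨S.square.domain, le_rfl, subset_closure, ‖B‖, fun x _ => ?_⟩
      rw [← hext B hB x]
      exact B.le_opNorm _
    tfae_have 3 → 2 := by
      rintro ⟨W, hW, hWd, C, hC⟩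
      -- A subspace dense in `D(S²)` is dense in all of `X`, hence in `D(P₊)`.
      refine ⟨W, hW.trans hle, fun x _ => closure_minimal hWd isClosed_closure (hsq x), C,
        fun x hx => ?_⟩
      exact (congrArg norm (H.Pplus_eq_Pint (hW hx) x.2)).trans_le (hC ⟨x, hW hx⟩ hx)
    tfae_have 2 → 1 := by
      intro hb
      obtain ⟨B, hB⟩ := hR.exists_eq_of_boundedOnDenseSubspace hPd hb
      exact ⟨_, _, H.isStrictlyDichotomousWrt_of_Aplus_eq hB⟩
    tfae_finish
  · intro hS
    obtain ⟨B, hB⟩ := H.exists_Aplus_eq_of_isStrictlyDichotomous hS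
    refine ⟨B, hR.square_pcomp_eq_ofCLM hB, hext B hB, fun B' hB' => ?_⟩
    exact ContinuousLinearMap.coeFn_injective (Continuous.ext_on hsq B'.continuous B.continuous
      fun x hx => (hB' ⟨x, hx⟩).trans (hext B hB ⟨x, hx⟩).symm)
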